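/- Setting. Let $\|\cdot\|$ be a norm on $\mathbb{R}^d$ with dual norm $\|v\|_*=\sup_{\|u\|=1}\langle v,u\rangle$, let $\mathcal{X}\subseteq\mathbb{R}^d$ be closed and convex with $0\in\mathcal{X}$, and let $\psi$ be a proximal function: continuous and $1$-strongly convex on $\mathcal{X}$ with respect to $\|\cdot\|$, with $\psi\ge 0$ on $\mathcal{X}$ and $\psi(0)=0$. Let $f_1,\dots,f_n:\mathbb{R}^d\to\mathbb{R}$ be convex and $L$-Lipschitz on $\mathcal{X}$ with respect to $\|\cdot\|$, and put $f=\frac1n\sum_{i=1}^n f_i$. Let $P$ be an $n\times n$ doubly stochastic matrix whose second largest singular value $\sigma_2(P)$ satisfies $\sigma_2(P)<1$ (with $\sigma_2(P)=0$ if $n=1$), and let $(\alpha(t))_{t\ge 0}$ be a non-increasing sequence of positive stepsizes. Nodes $i=1,\dots,n$ run distributed dual averaging: $z_i(1)=0$, $x_i(1)=\operatorname{argmin}_{x\in\mathcal{X}}\psi(x)=0$, and for $t=1,2,\dots$ node $i$ receives a random vector $\hat g_i(t)$ and sets $$z_i(t+1)=\sum_{j=1}^n P_{ij}z_j(t)+\hat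 g_i(t),\qquad x_i(t+1)=\operatorname*{argmin}_{x\in\mathcal{X}}\Big\{\langle z_i(t+1),x\rangle+\tfrac{1}{\alpha(t)}\psi(x)\Big\}.$$ Let $\hat x_i(T)=\frac1T\sum_{t=1}^T x_i(t)$, and let $(\mathcal{F}_t)_{t\ge 0}$ be a filtration such that $\hat g_i(t)$ is $\mathcal{F}_t$-measurable for all $i$ and $t\ge1$. Suppose that the $\hat g_i(t)$ are square integrable and that, almost surely, for all $i$ and $t\ge 1$, $$\mathbb{E}[\hat g_i(t)\mid\mathcal{F}_{t-1}]\in\partial f_i(x_i(t)),\qquad \mathbb{E}[\|\hat g_i(t)\|_*^2\mid\mathcal{F}_{t-1}]\le L^2 .$$ Theorem. Let $x^*\in\mathcal{X}$ and $T\ge 1$, and put $$B=\frac{1}{T\alpha(T)}\psi(x^*)+\frac{8L^2}{T}\sum_{t=1}^T\alpha(t-1)+\frac{3L^2}{T}\,\frac{\log(T\sqrt n)}{1-\sigma_2(P)}\sum_{t=1}^T\alpha(t).$$ For every node $i$: (1) $f(\hat x_i(T))$ is integrable and $\mathbb{E}[f(\hat x_i(T))]-f(x^*)\le B$. (2) If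 in addition $R=\sup_{x\in\mathcal{X}}\|x-x^*\|<\infty$ and $\|\hat g_j(t)\|_*\le L$ almost surely for all $j$ and $t\ge1$, then for every $\delta\in(0,1)$, with probability at least $1-\delta$, $$f(\hat x_i(T))-f(x^*)\le B+8LR\sqrt{\frac{\log(1/\delta)}{T}}.$$ (3) If, in addition to the assumptions of (2), for every $t\ge1$ and $j\ne k$ the vectors $\hat g_j(t)$ and $\hat g_k(t)$ are uncorrelated given $\mathcal{F}_{t-1}$ (their conditional cross-covariance matrix vanishes almost surely), then for every $\delta\in(0,1)$, with probability at least $1-\delta$, $$f(\hat x_i(T))-f(x^*)\le B+\frac{3LR\log(1/\delta)}{T}+4LR\sqrt{\frac{\log(1/\delta)}{nT}}.$$ -/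

import Mathlib

open MeasureTheory ProbabilityTheory Set
open scoped NNReal

noncomputable section

namespace DistributedDualAveraging

/-- The second largest singular value `σ₂(P)` of a real square matrix. Singular values are listed
in decreasing order, with multiplicity, starting from index `0`; for a `1 × 1` matrix the value is
`0` by convention. -/
def sigma2 {n : ℕ} (P : Matrix (Fin n) (Fin n) ℝ) : ℝ :=
  (Matrix.toEuclideanLin P).singularValues 1

section Deterministic

variable {E : Type*} [NormedAddCommGroup E] [NormedSpace ℝ E]

/-- The subdifferential `∂f(x)` of a real function at `x`. Vectors of `ℝ^d` acting by the pairing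
`⟨g, ·⟩` are elements of the dual space, whose operator norm is the dual norm. -/
def subdifferential (f : E → ℝ) (x : E) : Set (StrongDual ℝ E) :=
  {g | ∀ y, f x + g (y - x) ≤ f y}

/-- `x` is the projection `Π_X^ψ(z, a) = argmin_{x ∈ X} {⟨z, x⟩ + ψ(x) / a}`. -/
def IsProjection (X : Set E) (ψ : E → ℝ) (z : StrongDual ℝ E) (a : ℝ) (x : E) : Prop :=
  x ∈ X ∧ IsMinOn (fun y => z y + (1 / a) * ψ y) X x

/-- Standing assumptions on the proximal function: nonnegative and (continuous and) `1`-strongly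
convex on `X` with respect to the norm of `E`, and zero at the origin. -/
structure IsProximal (X : Set E) (ψ : E → ℝ) : Prop where
  continuousOn : ContinuousOn ψ X
  strongConvexOn : StrongConvexOn X 1 ψ
  nonneg : ∀ x ∈ X, 0 ≤ ψ x
  zero : ψ 0 = 0

/-- The sequences `x i t`, `z i t` (`t = 1, 2, …`) are generated by distributed dual averaging with
weight matrix `P`, stepsizes `α`, and vectors `g i t` received by node `i` in round `t`. The dual
variables start from zero. -/
structure IsDualAveraging {n : ℕ} (X : Set E) (ψ : E → ℝ) (P : Matrix (Fin n) (Fin n) ℝ)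
    (α : ℕ → ℝ) (g z : Fin n → ℕ → StrongDual ℝ E) (x : Fin n → ℕ → E) : Prop where
  init : ∀ i, z i 1 = 0
  dual_update : ∀ i t, 1 ≤ t → z i (t + 1) = ∑ j, P i j • z j t + g i t
  primal_update : ∀ i t, IsProjection X ψ (z i (t + 1)) (α t) (x i (t + 1))

/-- The global objective `f(x) = (1/n) ∑ᵢ fᵢ(x)`. -/
def objective {n : ℕ} (f : Fin n → E → ℝ) (x : E) : ℝ :=
  (1 / (n : ℝ)) * ∑ i, f i x

/-- The running average `x̂(T) = (1/T) ∑_{t=1}^T x(t)`. -/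
def runningAverage (x : ℕ → E) (T : ℕ) : E :=
  (1 / (T : ℝ)) • ∑ t ∈ Finset.Icc 1 T, x t

end Deterministic

section Stochastic

variable {Ω : Type*} {mΩ : MeasurableSpace Ω}
variable {E : Type*} [NormedAddCommGroup E] [NormedSpace ℝ E]

/-- The vectors `g i t` (`t = 1, 2, …`) come from a stochastic oracle: `g i t` is known at time `t`
and square integrable, its conditional mean given the past `ℱ (t - 1)` is a subgradient of `f i` at
`x i t`, and its conditional second moment is at most `L ^ 2`. The round is written `t + 1`. -/
structure IsStochasticOracle {n : ℕ} (μ : Measure Ω) (ℱ : Filtration ℕ mΩ) (f : Fin n → E → ℝ)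
    (L : ℝ≥0) (x : Fin n → ℕ → Ω → E) (g : Fin n → ℕ → Ω → StrongDual ℝ E) : Prop where
  adapted : ∀ i t, StronglyMeasurable[ℱ (t + 1)] (g i (t + 1))
  memLp : ∀ i t, MemLp (g i (t + 1)) 2 μ
  unbiased : ∀ i t, ∀ᵐ ω ∂μ, (μ[g i (t + 1) | ℱ t]) ω ∈ subdifferential (f i) (x i (t + 1) ω)
  second_moment : ∀ i t, ∀ᵐ ω ∂μ,
    (μ[fun ω' => ‖g i (t + 1) ω'‖ ^ 2 | ℱ t]) ω ≤ (L : ℝ) ^ 2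

/-- Two random (dual) vectors are uncorrelated given the sub-σ-algebra `m`: their conditional
cross-covariance, as a bilinear form on `E`, vanishes almost surely. -/
def CondUncorrelated (μ : Measure Ω) (m : MeasurableSpace Ω) (g h : Ω → StrongDual ℝ E) : Prop :=
  ∀ u v : E, μ[fun ω => (g ω - (μ[g | m]) ω) u * (h ω - (μ[h | m]) ω) v | m] =ᵐ[μ] 0

end Stochastic

/-- The part of the error bound that is common to all three claims:
`ψ(x*) / (T α(T)) + (8 L² / T) ∑_{t=1}^T α(t-1)
  + (3 L² / T) (log (T √n) / (1 - σ₂)) ∑_{t=1}^T α(t)`. -/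
def errorBound (n T : ℕ) (L : ℝ) (α : ℕ → ℝ) (ψstar σ₂ : ℝ) : ℝ :=
  1 / ((T : ℝ) * α T) * ψstar
    + 8 * L ^ 2 / T * ∑ t ∈ Finset.Icc 1 T, α (t - 1)
    + 3 * L ^ 2 / T * (Real.log ((T : ℝ) * √(n : ℝ)) / (1 - σ₂)) * ∑ t ∈ Finset.Icc 1 T, α t

end DistributedDualAveraging

end

noncomputable section
namespace DistributedDualAveraging

/-! ### Spectral gap: geometric mixing of doubly stochastic matrices. -/

section Spectral

variable {n : ℕ} {P : Matrix (Fin n) (Fin n) ℝ}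

/-! Since `P` is doubly stochastic, the mean of the dual variables simply accumulates the means of
the received vectors. Its projection, `center`, therefore runs centralized dual averaging, whose
regret (`dualAveraging_regret`) yields `ψ(x*)/α(T)` and half of the squared gradient sizes. By
Lipschitz continuity and the subgradient inequality, node `i` exceeds this regret only by a network
error (the mean distances of `x_i` to `x_j` and of `x_j` to the center) and by a noise term, linear
in the deviations of the received vectors from their conditional means (`sum_objective_sub_le`).

Network error. Let `K = ⌈log(T√n)/(1-σ₂)⌉`. Vectors received more than `K` rounds ago are mixed so
well that each such round counts at most a multiple of `1/T`. For `x_i - x_j`, a recent round costs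
at most `2L`, the ℓ¹ distance of two probability vectors times `L`. The same estimate for the
distance to the center would give a total of 4 per round; the constant 3 requires cost `L` there.
This comes from the Jensen gap of the conjugate of the regularizer over the nodes. Mixing does not
increase the gap, by convexity. Smoothness lets its square root grow by at most `√(a/2)` times the
root mean square of the new vectors. Co-coercivity bounds the mean square distance to the center by
`2a` times the gap. Starting from consensus, the mean distance thus grows by at most `a` times that
root mean square per round (`mean_norm_proxPoint_sub_le`). To look at only `K` rounds, the actual
process is compared with one restarted from consensus `K` rounds earlier.

Randomness. The conditional second moment bound gives conditional means of norm at most `L`, so the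
network error enters with the deterministic factor `L` and is linear in quantities with mean at most
`L`. The center is known before the vectors of its round, so the noise is a martingale difference
sequence: it vanishes in expectation, which gives (1). In the bounded case its terms are at most
`2LR`, and Azuma's inequality gives (2). If the nodes are conditionally uncorrelated, averaging
divides the conditional variance bound by `n`, and a Bernstein inequality gives (3). -/

lemma sigma2_nonneg (P : Matrix (Fin n) (Fin n) ℝ) : 0 ≤ sigma2 P :=
  LinearMap.singularValues_nonneg _ _

open InnerProductSpace in
/-- Away from the constant vectors, a doubly stochastic matrix contracts by its second singular
value, provided that this value is less than one. -/
lemma norm_toEuclideanLin_le (hP : P ∈ doublyStochastic ℝ (Fin n)) (hgap : sigma2 P < 1)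
    {v : EuclideanSpace ℝ (Fin n)} (hv : ∑ i, v i = 0) :
    ‖Matrix.toEuclideanLin P v‖ ≤ sigma2 P * ‖v‖ := by
  set A := Matrix.toEuclideanLin P with hA
  have hdim : Module.finrank ℝ (EuclideanSpace ℝ (Fin n)) = n := by simp
  have hS := A.isSymmetric_adjoint_comp_self
  set b := hS.eigenvectorBasis hdim with hb
  set ev := hS.eigenvalues hdim with hev
  let one : EuclideanSpace ℝ (Fin n) := WithLp.toLp 2 fun _ => 1
  have hone : (LinearMap.adjoint A ∘ₗ A) one = one := by
    have h1 : A one = one := by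
      ext i
      have := (mem_doublyStochastic_iff_sum.1 hP).2.1 i
      simp [hA, one, Matrix.mulVec, dotProduct, this]
    have h2 : LinearMap.adjoint A one = one := by
      rw [hA, ← Matrix.toEuclideanLin_conjTranspose_eq_adjoint]
      ext i
      have := (mem_doublyStochastic_iff_sum.1 hP).2.2 i
      simp [one, Matrix.mulVec, dotProduct, this]
    simp [h1, h2]
  have hevle : ∀ i : Fin n, 1 ≤ (i : ℕ) → ev i ≤ sigma2 P ^ 2 := by
    intro i hi
    rw [hev, ← A.sq_singularValues_fin hdim i]
    exact pow_le_pow_left₀ (LinearMap.singularValues_nonneg _ _)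
      (A.singularValues_antitone hi) 2
  have hsq : sigma2 P ^ 2 < 1 := by nlinarith [sigma2_nonneg P]
  -- The constant vector is fixed by `A* A`, so it has no component in eigendirections with
  -- eigenvalue below one. Hence it is parallel to the eigenvector of index 0, and `v`, being
  -- orthogonal to it, has no component there.
  have hortho : ∀ i : Fin n, 1 ≤ (i : ℕ) → inner ℝ (b i) one = 0 := by
    intro i hi
    have h1 : inner ℝ (b i) ((LinearMap.adjoint A ∘ₗ A) one)
        = ev i * inner ℝ (b i) one := by
      rw [← hS (b i) one, hb, hS.apply_eigenvectorBasis hdim i, inner_smul_left]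
      rfl
    rw [hone] at h1
    have := hevle i hi
    have h2 : (1 - ev i) * inner ℝ (b i) one = 0 := by linarith
    rcases mul_eq_zero.1 h2 with h | h
    · linarith
    · exact h
  have hvone : inner ℝ v one = 0 := by
    simpa [one, PiLp.inner_apply] using hv
  have hv0 : ∀ i : Fin n, (i : ℕ) = 0 → inner ℝ (b i) v = 0 := by
    intro i hi
    have h1 : ∑ j, inner ℝ v (b j) * inner ℝ (b j) one = inner ℝ v one :=
      b.sum_inner_mul_inner v one
    have h2 : ∑ j, inner ℝ one (b j) * inner ℝ (b j) one = inner ℝ one one :=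
      b.sum_inner_mul_inner one one
    have hother : ∀ j, j ≠ i → inner ℝ (b j) one = 0 := fun j hj =>
      hortho j (Nat.one_le_iff_ne_zero.2 fun h => hj (Fin.ext (h.trans hi.symm)))
    rw [Finset.sum_eq_single i (fun j _ hj => by rw [hother j hj, mul_zero]) (by simp)] at h1 h2
    have hpos : inner ℝ one one ≠ 0 := by
      have : 0 < n := i.pos
      have h : inner ℝ one one = (n : ℝ) := by simp only [one, PiLp.inner_apply]; simp
      rw [h]
      exact_mod_cast this.ne'
    rw [hvone] at h1
    rcases mul_eq_zero.1 h1 with h | h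
    · rwa [real_inner_comm]
    · rw [h, mul_zero] at h2
      exact absurd h2.symm hpos
  have hexp : ‖A v‖ ^ 2 = ∑ i, ev i * inner ℝ (b i) v ^ 2 := by
    rw [← real_inner_self_eq_norm_sq, ← LinearMap.adjoint_inner_left]
    have := b.sum_inner_mul_inner ((LinearMap.adjoint A ∘ₗ A) v) v
    rw [← LinearMap.comp_apply, ← this]
    refine Finset.sum_congr rfl fun i _ => ?_
    rw [hS v (b i), hS.apply_eigenvectorBasis hdim i, inner_smul_right, real_inner_comm v (b i)]
    simp only [hev, RCLike.ofReal_real_eq_id, id]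
    ring
  have hnv : ∑ i, inner ℝ (b i) v ^ 2 = ‖v‖ ^ 2 := by
    rw [← b.sum_sq_norm_inner_right v]
    simp
  have hle : ‖A v‖ ^ 2 ≤ (sigma2 P * ‖v‖) ^ 2 := by
    rw [hexp, mul_pow, ← hnv, Finset.mul_sum]
    refine Finset.sum_le_sum fun i _ => ?_
    by_cases hi : (i : ℕ) = 0
    · simp [hv0 i hi]
    · exact mul_le_mul_of_nonneg_right (hevle i (Nat.one_le_iff_ne_zero.2 hi)) (sq_nonneg _)
  exact le_of_sq_le_sq hle (mul_nonneg (sigma2_nonneg P) (norm_nonneg v))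

lemma sum_toEuclideanLin_transpose (hP : P ∈ doublyStochastic ℝ (Fin n))
    (v : EuclideanSpace ℝ (Fin n)) :
    ∑ i, Matrix.toEuclideanLin P.transpose v i = ∑ i, v i := by
  simp only [Matrix.toLpLin_apply, Matrix.mulVec, dotProduct, Matrix.transpose_apply]
  rw [Finset.sum_comm]
  refine Finset.sum_congr rfl fun i _ => ?_
  rw [← Finset.sum_mul, (mem_doublyStochastic_iff_sum.1 hP).2.1 i, one_mul]

/-- By duality, `‖Pᵀv‖² = ⟨v, P Pᵀv⟩`, and `Pᵀv` again has zero sum. The transpose is needed because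
a row of `P ^ k` evolves under `Pᵀ`. -/
lemma norm_toEuclideanLin_transpose_le (hP : P ∈ doublyStochastic ℝ (Fin n))
    (hgap : sigma2 P < 1) {v : EuclideanSpace ℝ (Fin n)} (hv : ∑ i, v i = 0) :
    ‖Matrix.toEuclideanLin P.transpose v‖ ≤ sigma2 P * ‖v‖ := by
  set w := Matrix.toEuclideanLin P.transpose v with hw
  have hw0 : ∑ i, w i = 0 := (sum_toEuclideanLin_transpose hP v).trans hv
  have hadj : w = LinearMap.adjoint (Matrix.toEuclideanLin P) v := by
    rw [← Matrix.toEuclideanLin_conjTranspose_eq_adjoint,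
      Matrix.conjTranspose_eq_transpose_of_trivial]
  have h1 : ‖w‖ ^ 2 = inner ℝ v (Matrix.toEuclideanLin P w) := by
    rw [← real_inner_self_eq_norm_sq]
    nth_rewrite 1 [hadj]
    rw [LinearMap.adjoint_inner_left]
  have h2 : ‖w‖ ^ 2 ≤ ‖v‖ * (sigma2 P * ‖w‖) :=
    h1.le.trans ((real_inner_le_norm _ _).trans
      (mul_le_mul_of_nonneg_left (norm_toEuclideanLin_le hP hgap hw0) (norm_nonneg _)))
  rcases (norm_nonneg w).eq_or_lt with h | h
  · rw [← h]; exact mul_nonneg (sigma2_nonneg P) (norm_nonneg v)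
  · nlinarith

/-- The rows of the powers of `P` approach the uniform distribution geometrically. -/
lemma sum_sq_pow_sub_le (hP : P ∈ doublyStochastic ℝ (Fin n)) (hgap : sigma2 P < 1)
    (i : Fin n) (k : ℕ) :
    ∑ j, ((P ^ k) i j - 1 / n) ^ 2 ≤ (sigma2 P ^ k) ^ 2 := by
  have hn : (n : ℝ) ≠ 0 := Nat.cast_ne_zero.2 i.pos.ne'
  let d : ℕ → EuclideanSpace ℝ (Fin n) := fun k => WithLp.toLp 2 fun j => (P ^ k) i j - 1 / n
  have hsum : ∀ k, ∑ j, d k j = 0 := by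
    intro k
    have := (mem_doublyStochastic_iff_sum.1 (Submonoid.pow_mem _ hP k)).2.1 i
    simp [d, this, hn]
  have hstep : ∀ k, d (k + 1) = Matrix.toEuclideanLin P.transpose (d k) := by
    intro k
    ext j
    have h1 := (mem_doublyStochastic_iff_sum.1 hP).2.2 j
    simp only [d, Matrix.toLpLin_apply, Matrix.mulVec, dotProduct, Matrix.transpose_apply,
      pow_succ, Matrix.mul_apply, mul_sub, Finset.sum_sub_distrib, ← Finset.sum_mul, h1, one_mul]
    simp only [mul_comm]
  have hnorm : ∀ k, ‖d k‖ ≤ sigma2 P ^ k * ‖d 0‖ := by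
    intro k
    induction k with
    | zero => simp
    | succ k ih =>
      rw [hstep, pow_succ', mul_assoc]
      exact (norm_toEuclideanLin_transpose_le hP hgap (hsum k)).trans
        (mul_le_mul_of_nonneg_left ih (sigma2_nonneg P))
  have hd0 : ‖d 0‖ ≤ 1 := by
    have hsq : ‖d 0‖ ^ 2 = 1 - 1 / n := by
      rw [EuclideanSpace.norm_sq_eq]
      simp only [d, pow_zero, Real.norm_eq_abs, sq_abs, Matrix.one_apply, sub_sq]
      simp [Finset.sum_add_distrib, Finset.sum_sub_distrib, ite_pow]
      field_simp
      ring
    have : (0 : ℝ) ≤ 1 / n := by positivity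
    nlinarith [norm_nonneg (d 0)]
  have h := (hnorm k).trans (mul_le_of_le_one_right (pow_nonneg (sigma2_nonneg P) k) hd0)
  have h2 : ‖d k‖ ^ 2 = ∑ j, ((P ^ k) i j - 1 / n) ^ 2 := by
    rw [EuclideanSpace.norm_sq_eq]
    simp [d]
  rw [← h2]
  exact pow_le_pow_left₀ (norm_nonneg _) h 2

/-- Two probability vectors have ℓ¹ distance at most 2. This serves for the recent rounds, for which
no mixing is available. -/
lemma sum_abs_pow_sub_pow_le (hP : P ∈ doublyStochastic ℝ (Fin n)) (i j : Fin n) (k : ℕ) :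
    ∑ l, |(P ^ k) i l - (P ^ k) j l| ≤ 2 := by
  have h := mem_doublyStochastic_iff_sum.1 (Submonoid.pow_mem _ hP k)
  calc ∑ l, |(P ^ k) i l - (P ^ k) j l| ≤ ∑ l, ((P ^ k) i l + (P ^ k) j l) := by
        refine Finset.sum_le_sum fun l _ => abs_le.2 ⟨?_, ?_⟩ <;>
          linarith [h.1 i l, h.1 j l]
    _ = 2 := by rw [Finset.sum_add_distrib, h.2.1 i, h.2.1 j]; norm_num

/-- The weighted deviation of the rows of `P ^ k` from uniform, by Cauchy–Schwarz. -/
lemma sum_abs_pow_sub_mul_le (hP : P ∈ doublyStochastic ℝ (Fin n)) (hgap : sigma2 P < 1)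
    (i : Fin n) (k : ℕ) (e : Fin n → ℝ) :
    ∑ l, |(P ^ k) i l - 1 / n| * e l
      ≤ √n * sigma2 P ^ k * √((1 / n) * ∑ l, e l ^ 2) := by
  have hn : (0 : ℝ) < n := Nat.cast_pos.2 i.pos
  have h1 := Real.sum_mul_le_sqrt_mul_sqrt Finset.univ (fun l => |(P ^ k) i l - 1 / n|) e
  simp only [sq_abs] at h1
  have h2 : √(∑ l, ((P ^ k) i l - 1 / n) ^ 2) ≤ sigma2 P ^ k :=
    Real.sqrt_le_iff.2 ⟨pow_nonneg (sigma2_nonneg P) k, sum_sq_pow_sub_le hP hgap i k⟩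
  have h3 : √(∑ l, e l ^ 2) = √n * √((1 / n) * ∑ l, e l ^ 2) := by
    rw [← Real.sqrt_mul hn.le]
    congr 1
    field_simp
  rw [h3] at h1
  refine h1.trans ?_
  calc _ ≤ sigma2 P ^ k * (√n * √((1 / n) * ∑ l, e l ^ 2)) :=
        mul_le_mul_of_nonneg_right h2 (by positivity)
    _ = _ := by ring

/-- After `⌈log (T √n) / (1 - σ₂)⌉` rounds the deviation from consensus is at most `1 / T`. -/
lemma sqrt_mul_sigma2_pow_le (hgap : sigma2 P < 1) {T K : ℕ} (hn : 0 < n) (hT : 1 ≤ T)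
    (hK : Real.log (T * √n) / (1 - sigma2 P) ≤ K) :
    √n * sigma2 P ^ K ≤ 1 / T := by
  have hn' : (0 : ℝ) < √n := Real.sqrt_pos.2 (Nat.cast_pos.2 hn)
  have hT' : (0 : ℝ) < T := Nat.cast_pos.2 hT
  -- This turns a power of `σ₂` into an exponential, so that `1 - σ₂` can take the place of `-log
  -- σ₂` in the mixing time.
  have h1 : sigma2 P ≤ Real.exp (-(1 - sigma2 P)) := by
    have := Real.add_one_le_exp (-(1 - sigma2 P)); linarith
  have h2 : sigma2 P ^ K ≤ Real.exp (-(Real.log (T * √n))) := by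
    refine (pow_le_pow_left₀ (sigma2_nonneg P) h1 K).trans ?_
    rw [← Real.exp_nat_mul]
    apply Real.exp_le_exp.2
    rw [div_le_iff₀ (by linarith)] at hK
    linarith
  rw [Real.exp_neg, Real.exp_log (by positivity)] at h2
  calc √n * sigma2 P ^ K ≤ √n * (T * √n)⁻¹ := mul_le_mul_of_nonneg_left h2 hn'.le
    _ = 1 / T := by field_simp

end Spectral

/-! ### Projections, the conjugate of the regularizer, and centralized dual averaging. -/

section Prox

variable {E : Type*} [NormedAddCommGroup E] [NormedSpace ℝ E]
variable {X : Set E} {ψ : E → ℝ} {z w : StrongDual ℝ E} {a : ℝ} {x y : E}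

/-- Quadratic growth of the regularized linear functional around its minimizer. -/
lemma IsProjection.quadratic_growth (hψ : StrongConvexOn X 1 ψ) (ha : 0 < a)
    (hx : IsProjection X ψ z a x) (hy : y ∈ X) :
    z x + 1 / a * ψ x + 1 / (2 * a) * ‖y - x‖ ^ 2 ≤ z y + 1 / a * ψ y := by
  obtain ⟨hxX, hmin⟩ := hx
  -- Minimality at `x` against the point `(1 - s)x + sy`, with strong convexity, gives the claim up
  -- to the factor `1 - s` after division by `s`; then `s → 0`.
  have key : ∀ s : ℝ, 0 < s → s < 1 →
      z x + 1 / a * ψ x + (1 - s) * (1 / (2 * a) * ‖y - x‖ ^ 2) ≤ z y + 1 / a * ψ y := by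
    intro s hs hs1
    have hc := hψ.2 hxX hy (sub_nonneg.2 hs1.le) hs.le (by ring)
    have hm : z x + 1 / a * ψ x
        ≤ z ((1 - s) • x + s • y) + 1 / a * ψ ((1 - s) • x + s • y) :=
      hmin (hψ.1 hxX hy (sub_nonneg.2 hs1.le) hs.le (by ring))
    simp only [smul_eq_mul, map_add, map_smul] at hc hm
    rw [norm_sub_rev x y] at hc
    have h1 : 1 / a * ψ ((1 - s) • x + s • y) ≤ 1 / a * ((1 - s) * ψ x + s * ψ y
        - (1 - s) * s * (1 / 2 * ‖y - x‖ ^ 2)) :=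
      mul_le_mul_of_nonneg_left hc (by positivity)
    have h2 : s * (z x + 1 / a * ψ x + (1 - s) * (1 / (2 * a) * ‖y - x‖ ^ 2))
        ≤ s * (z y + 1 / a * ψ y) := by
      have h3 : 1 / (2 * a) = 1 / a * (1 / 2) := by field_simp
      rw [h3]
      linarith
    exact le_of_mul_le_mul_left h2 hs
  refine le_of_forall_pos_le_add fun ε hε => ?_
  set D := 1 / (2 * a) * ‖y - x‖ ^ 2 with hD
  have hD0 : 0 ≤ D := by positivity
  have hs : 0 < min (1 / 2) (ε / (D + 1)) := by positivity
  have := key (min (1 / 2) (ε / (D + 1))) hs ((min_le_left _ _).trans_lt (by norm_num))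
  have h4 : min (1 / 2) (ε / (D + 1)) * D ≤ ε := by
    calc min (1 / 2) (ε / (D + 1)) * D ≤ ε / (D + 1) * (D + 1) :=
          mul_le_mul (min_le_right _ _) (by linarith) hD0 (by positivity)
      _ = ε := by field_simp
  linarith

/-- Add the quadratic growth inequalities of the two minimizers, each tested at the other one: the
`ψ` terms cancel. -/
lemma IsProjection.norm_sub_le (hψ : StrongConvexOn X 1 ψ) (ha : 0 < a)
    (hx : IsProjection X ψ z a x) (hy : IsProjection X ψ w a y) :
    ‖x - y‖ ≤ a * ‖z - w‖ := by
  have h1 := hx.quadratic_growth hψ ha hy.1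
  have h2 := hy.quadratic_growth hψ ha hx.1
  rw [norm_sub_rev y x] at h1
  have h3 : (z - w) (y - x) ≤ ‖z - w‖ * ‖x - y‖ := by
    rw [norm_sub_rev x y]
    exact (le_abs_self _).trans ((z - w).le_opNorm _)
  simp only [sub_apply, map_sub] at h3
  have h4 : 1 / (2 * a) * ‖x - y‖ ^ 2 + 1 / (2 * a) * ‖x - y‖ ^ 2 = ‖x - y‖ ^ 2 / a := by
    field_simp; ring
  have h5 : ‖x - y‖ ^ 2 / a ≤ ‖z - w‖ * ‖x - y‖ := by linarith
  rw [div_le_iff₀ ha] at h5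
  rcases (norm_nonneg (x - y)).eq_or_lt with h | h
  · rw [← h]; positivity
  · nlinarith

lemma IsProximal.half_sq_norm_le (hψ : IsProximal X ψ) (hX0 : (0 : E) ∈ X) (hy : y ∈ X) :
    1 / 2 * ‖y‖ ^ 2 ≤ ψ y := by
  have h0 : IsProjection X ψ 0 1 0 :=
    ⟨hX0, fun y hy => by simpa [hψ.zero] using hψ.nonneg y hy⟩
  have := h0.quadratic_growth hψ.strongConvexOn one_pos hy
  simpa [hψ.zero] using this

/-- Since `ψ` dominates `‖·‖²/2`, the objective is nonnegative outside the ball of radius `2a‖z‖`,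
hence no better than its value 0 at the origin. Compactness does the rest. -/
lemma exists_isProjection [FiniteDimensional ℝ E] (hX : IsClosed X) (hX0 : (0 : E) ∈ X)
    (hψ : IsProximal X ψ) (z : StrongDual ℝ E) (ha : 0 < a) :
    ∃ x, IsProjection X ψ z a x := by
  set r := 2 * a * ‖z‖ with hr
  have hcompact : IsCompact (X ∩ Metric.closedBall 0 r) :=
    (isCompact_closedBall 0 r).inter_left hX
  have hcont : ContinuousOn (fun y => z y + 1 / a * ψ y) (X ∩ Metric.closedBall 0 r) :=
    z.continuous.continuousOn.add
      (continuousOn_const.mul (hψ.continuousOn.mono inter_subset_left))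
  have h0 : (0 : E) ∈ X ∩ Metric.closedBall 0 r :=
    ⟨hX0, Metric.mem_closedBall_self (by positivity)⟩
  obtain ⟨x, hx, hmin⟩ := hcompact.exists_isMinOn ⟨0, h0⟩ hcont
  refine ⟨x, hx.1, fun y hy => ?_⟩
  by_cases hyr : ‖y‖ ≤ r
  · exact hmin ⟨hy, by simpa using hyr⟩
  · have h1 : z x + 1 / a * ψ x ≤ z 0 + 1 / a * ψ 0 := hmin h0
    simp only [map_zero, hψ.zero, mul_zero, add_zero] at h1
    have h2 := hψ.half_sq_norm_le hX0 hy
    have h3 : -(‖z‖ * ‖y‖) ≤ z y := (neg_le_neg (z.le_opNorm y)).trans (neg_abs_le _)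
    have h4 : ‖z‖ * ‖y‖ ≤ 1 / a * (1 / 2 * ‖y‖ ^ 2) := by
      rw [not_le] at hyr
      have : ‖z‖ * ‖y‖ = 1 / a * (1 / 2 * (r * ‖y‖)) := by rw [hr]; field_simp
      rw [this]
      have hy0 : 0 ≤ ‖y‖ := norm_nonneg y
      gcongr
      nlinarith
    have h5 : 1 / a * (1 / 2 * ‖y‖ ^ 2) ≤ 1 / a * ψ y :=
      mul_le_mul_of_nonneg_left h2 (by positivity)
    change z x + 1 / a * ψ x ≤ z y + 1 / a * ψ y
    linarith

/-- A choice of the projection `Π_X^ψ(z, a)`. -/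
def proxPoint (X : Set E) (ψ : E → ℝ) (a : ℝ) (z : StrongDual ℝ E) : E :=
  Classical.epsilon (IsProjection X ψ z a)

lemma isProjection_proxPoint [FiniteDimensional ℝ E] (hX : IsClosed X) (hX0 : (0 : E) ∈ X)
    (hψ : IsProximal X ψ) (ha : 0 < a) (z : StrongDual ℝ E) :
    IsProjection X ψ z a (proxPoint X ψ a z) :=
  Classical.epsilon_spec (exists_isProjection hX hX0 hψ z ha)

lemma IsProjection.eq_of_isProjection (hψ : StrongConvexOn X 1 ψ) (ha : 0 < a)
    (hx : IsProjection X ψ z a x) (hy : IsProjection X ψ z a y) : x = y := by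
  have := hx.norm_sub_le hψ ha hy
  rw [sub_self, norm_zero, mul_zero] at this
  exact sub_eq_zero.1 (norm_le_zero_iff.1 this)

/-- The value `max_{x ∈ X} {-⟨z, x⟩ - ψ(x) / a}` of the conjugate of the regularizer at `-z`. -/
def conjugate (X : Set E) (ψ : E → ℝ) (a : ℝ) (z : StrongDual ℝ E) : ℝ :=
  -(z (proxPoint X ψ a z) + 1 / a * ψ (proxPoint X ψ a z))

variable [FiniteDimensional ℝ E]

lemma neg_le_conjugate (hX : IsClosed X) (hX0 : (0 : E) ∈ X) (hψ : IsProximal X ψ) (ha : 0 < a)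
    (z : StrongDual ℝ E) (hy : y ∈ X) : -(z y + 1 / a * ψ y) ≤ conjugate X ψ a z :=
  neg_le_neg ((isProjection_proxPoint hX hX0 hψ ha z).2 hy)

/-- Co-coercivity of the conjugate. -/
lemma conjugate_add_le (hX : IsClosed X) (hX0 : (0 : E) ∈ X) (hψ : IsProximal X ψ) (ha : 0 < a)
    (z w : StrongDual ℝ E) :
    conjugate X ψ a z - (w - z) (proxPoint X ψ a z)
      + 1 / (2 * a) * ‖proxPoint X ψ a w - proxPoint X ψ a z‖ ^ 2 ≤ conjugate X ψ a w := by
  have hz := isProjection_proxPoint hX hX0 hψ ha z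
  have h := (isProjection_proxPoint hX hX0 hψ ha w).quadratic_growth hψ.strongConvexOn ha hz.1
  rw [norm_sub_rev]
  simp only [conjugate, sub_apply]
  linarith

/-- Smoothness of the conjugate. -/
lemma conjugate_add_smooth (hX : IsClosed X) (hX0 : (0 : E) ∈ X) (hψ : IsProximal X ψ)
    (ha : 0 < a) (z g : StrongDual ℝ E) :
    conjugate X ψ a (z + g)
      ≤ conjugate X ψ a z - g (proxPoint X ψ a z) + a / 2 * ‖g‖ ^ 2 := by
  have hz := isProjection_proxPoint hX hX0 hψ ha z
  have hw := isProjection_proxPoint hX hX0 hψ ha (z + g)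
  have h := hz.quadratic_growth hψ.strongConvexOn ha hw.1
  set p := proxPoint X ψ a z
  set q := proxPoint X ψ a (z + g)
  have h1 : g (p - q) ≤ ‖g‖ * ‖q - p‖ := by
    rw [norm_sub_rev]; exact (le_abs_self _).trans (g.le_opNorm _)
  have h2 : ‖g‖ * ‖q - p‖ ≤ a / 2 * ‖g‖ ^ 2 + 1 / (2 * a) * ‖q - p‖ ^ 2 := by
    have : a / 2 * ‖g‖ ^ 2 + 1 / (2 * a) * ‖q - p‖ ^ 2 - ‖g‖ * ‖q - p‖
        = 1 / (2 * a) * (a * ‖g‖ - ‖q - p‖) ^ 2 := by field_simp; ring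
    have h3 : 0 ≤ 1 / (2 * a) * (a * ‖g‖ - ‖q - p‖) ^ 2 := by positivity
    linarith
  simp only [conjugate, add_apply, map_sub] at *
  linarith

/-- As `ψ ≥ 0`, a smaller stepsize penalizes every point more. This is what lets the stepsize
decrease between rounds. -/
lemma conjugate_anti (hX : IsClosed X) (hX0 : (0 : E) ∈ X) (hψ : IsProximal X ψ)
    {a b : ℝ} (hb : 0 < b) (hba : b ≤ a) (z : StrongDual ℝ E) :
    conjugate X ψ b z ≤ conjugate X ψ a z := by
  have hz := isProjection_proxPoint hX hX0 hψ hb z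
  have h1 := neg_le_conjugate hX hX0 hψ (hb.trans_le hba) z hz.1
  have h2 : 1 / a * ψ (proxPoint X ψ b z) ≤ 1 / b * ψ (proxPoint X ψ b z) :=
    mul_le_mul_of_nonneg_right (one_div_le_one_div_of_le hb hba) (hψ.nonneg _ hz.1)
  unfold conjugate at *
  linarith

lemma conjugate_zero_le (hX : IsClosed X) (hX0 : (0 : E) ∈ X) (hψ : IsProximal X ψ)
    (ha : 0 < a) : conjugate X ψ a 0 ≤ 0 := by
  have h := hψ.nonneg _ (isProjection_proxPoint hX hX0 hψ ha 0).1
  simp only [conjugate, zero_apply, zero_add]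
  exact neg_nonpos.2 (by positivity)

lemma norm_proxPoint_sub_le (hX : IsClosed X) (hX0 : (0 : E) ∈ X) (hψ : IsProximal X ψ)
    (ha : 0 < a) (z w : StrongDual ℝ E) :
    ‖proxPoint X ψ a z - proxPoint X ψ a w‖ ≤ a * ‖z - w‖ :=
  (isProjection_proxPoint hX hX0 hψ ha z).norm_sub_le hψ.strongConvexOn ha
    (isProjection_proxPoint hX hX0 hψ ha w)

lemma proxPoint_zero (hX : IsClosed X) (hX0 : (0 : E) ∈ X) (hψ : IsProximal X ψ)
    (ha : 0 < a) : proxPoint X ψ a 0 = 0 :=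
  (isProjection_proxPoint hX hX0 hψ ha 0).eq_of_isProjection hψ.strongConvexOn ha
    ⟨hX0, fun y hy => by
      simpa [hψ.zero] using mul_nonneg (inv_nonneg.2 ha.le) (hψ.nonneg y hy)⟩

lemma norm_proxPoint_le (hX : IsClosed X) (hX0 : (0 : E) ∈ X) (hψ : IsProximal X ψ)
    (ha : 0 < a) (z : StrongDual ℝ E) : ‖proxPoint X ψ a z‖ ≤ a * ‖z‖ := by
  simpa [proxPoint_zero hX hX0 hψ ha] using norm_proxPoint_sub_le hX hX0 hψ ha z 0

lemma continuous_proxPoint (hX : IsClosed X) (hX0 : (0 : E) ∈ X) (hψ : IsProximal X ψ)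
    (ha : 0 < a) : Continuous (proxPoint X ψ a) :=
  (LipschitzWith.of_dist_le_mul (K := ⟨a, ha.le⟩) fun z w => by
    rw [dist_eq_norm, dist_eq_norm]
    exact norm_proxPoint_sub_le hX hX0 hψ ha z w).continuous

/-- Regret bound of dual averaging for a sequence of linear losses. -/
lemma dualAveraging_regret (hX : IsClosed X) (hX0 : (0 : E) ∈ X) (hψ : IsProximal X ψ)
    {α : ℕ → ℝ} (hα : ∀ t, 0 < α t) (hanti : Antitone α) (g : ℕ → StrongDual ℝ E)
    {xs : E} (hxs : xs ∈ X) (T : ℕ) :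
    ∑ m ∈ Finset.range T, g m (proxPoint X ψ (α m) (∑ q ∈ Finset.range m, g q) - xs)
      ≤ 1 / α T * ψ xs + ∑ m ∈ Finset.range T, α m / 2 * ‖g m‖ ^ 2 := by
  -- The conjugate at the accumulated vectors is the potential: smoothness bounds its change in a
  -- round, and decreasing the stepsize only lowers it. Its final value is compared with the
  -- competitor `xs` by the Fenchel inequality.
  have key : ∀ T : ℕ,
      ∑ m ∈ Finset.range T, g m (proxPoint X ψ (α m) (∑ q ∈ Finset.range m, g q))
        + conjugate X ψ (α T) (∑ q ∈ Finset.range T, g q)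
      ≤ ∑ m ∈ Finset.range T, α m / 2 * ‖g m‖ ^ 2 := by
    intro T
    induction T with
    | zero => simpa using conjugate_zero_le hX hX0 hψ (hα 0)
    | succ T ih =>
      have h1 := conjugate_anti hX hX0 hψ (hα (T + 1)) (hanti T.le_succ)
        (∑ q ∈ Finset.range (T + 1), g q)
      have h2 := conjugate_add_smooth hX hX0 hψ (hα T) (∑ q ∈ Finset.range T, g q) (g T)
      rw [← Finset.sum_range_succ] at h2
      rw [Finset.sum_range_succ (fun m => g m _), Finset.sum_range_succ (fun m => _ * _)]
      linarith
  have h1 := key T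
  have h2 := neg_le_conjugate hX hX0 hψ (hα T) (∑ q ∈ Finset.range T, g q) hxs
  simp only [map_sub, Finset.sum_sub_distrib]
  rw [sum_apply] at h2
  linarith

end Prox

/-! ### Averaging over the network and the unrolled recursion. -/

section Network

variable {n : ℕ} {P Q : Matrix (Fin n) (Fin n) ℝ}

/-- The average of the vectors held by the nodes. -/
def mean {F : Type*} [AddCommGroup F] [Module ℝ F] (v : Fin n → F) : F :=
  (1 / (n : ℝ)) • ∑ j, v j

/-- One round of averaging with the weights `P`. -/
def mix {F : Type*} [AddCommGroup F] [Module ℝ F] (P : Matrix (Fin n) (Fin n) ℝ) (v : Fin n → F)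
    (j : Fin n) : F :=
  ∑ k, P j k • v k

/-- The root mean square. -/
def rms (e : Fin n → ℝ) : ℝ := √((1 / (n : ℝ)) * ∑ j, e j ^ 2)

lemma rms_nonneg (e : Fin n → ℝ) : 0 ≤ rms e := Real.sqrt_nonneg _

lemma sq_rms (e : Fin n → ℝ) : rms e ^ 2 = (1 / (n : ℝ)) * ∑ j, e j ^ 2 :=
  Real.sq_sqrt (by positivity)

lemma mean_mul_le_rms_mul_rms (c d : Fin n → ℝ) :
    (1 / (n : ℝ)) * ∑ j, c j * d j ≤ rms c * rms d := by
  unfold rms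
  rw [Real.sqrt_mul (by positivity), Real.sqrt_mul (by positivity)]
  have h := Real.sum_mul_le_sqrt_mul_sqrt Finset.univ c d
  have h1 : √(1 / (n : ℝ)) * √(1 / (n : ℝ)) = 1 / n := Real.mul_self_sqrt (by positivity)
  calc (1 / (n : ℝ)) * ∑ j, c j * d j
      ≤ (1 / (n : ℝ)) * (√(∑ j, c j ^ 2) * √(∑ j, d j ^ 2)) :=
        mul_le_mul_of_nonneg_left h (by positivity)
    _ = √(1 / (n : ℝ)) * √(1 / (n : ℝ)) * (√(∑ j, c j ^ 2) * √(∑ j, d j ^ 2)) := by rw [h1]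
    _ = _ := by ring

lemma mean_le_rms (c : Fin n → ℝ) : (1 / (n : ℝ)) * ∑ j, c j ≤ rms c := by
  have h := mean_mul_le_rms_mul_rms c (fun _ => 1)
  simp only [mul_one] at h
  refine h.trans (mul_le_of_le_one_right (rms_nonneg c) ?_)
  refine Real.sqrt_le_one.2 ?_
  simp only [one_pow, Finset.sum_const, Finset.card_univ, Fintype.card_fin, nsmul_eq_mul, mul_one]
  rw [one_div]
  exact inv_mul_le_one

section Module

variable {F : Type*} [AddCommGroup F] [Module ℝ F]

lemma mean_const (hn : 0 < n) (c : F) : mean (fun _ : Fin n => c) = c := by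
  have : (n : ℝ) ≠ 0 := Nat.cast_ne_zero.2 hn.ne'
  simp [mean, ← Nat.cast_smul_eq_nsmul ℝ, smul_smul, this]

lemma mean_add (v w : Fin n → F) : mean (fun j => v j + w j) = mean v + mean w := by
  simp [mean, Finset.sum_add_distrib]

lemma sum_mix (hP : P ∈ doublyStochastic ℝ (Fin n)) (v : Fin n → F) :
    ∑ j, mix P v j = ∑ j, v j := by
  unfold mix
  rw [Finset.sum_comm]
  refine Finset.sum_congr rfl fun k _ => ?_
  rw [← Finset.sum_smul, (mem_doublyStochastic_iff_sum.1 hP).2.2 k, one_smul]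

lemma mean_mix (hP : P ∈ doublyStochastic ℝ (Fin n)) (v : Fin n → F) :
    mean (mix P v) = mean v := by
  rw [mean, mean, sum_mix hP]

lemma mix_mix (v : Fin n → F) : mix P (mix Q v) = mix (P * Q) v := by
  funext j
  simp only [mix, Matrix.mul_apply, Finset.sum_smul, Finset.smul_sum, smul_smul]
  rw [Finset.sum_comm]

lemma mix_sum {ι : Type*} (s : Finset ι) (v : ι → Fin n → F) :
    mix P (fun j => ∑ q ∈ s, v q j) = fun j => ∑ q ∈ s, mix P (v q) j := by
  funext j
  simp only [mix, Finset.smul_sum]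
  rw [Finset.sum_comm]

variable {Z g : ℕ → Fin n → F}

/-- The vector `g q` is added after the mixing of its own round, so by time `m` it has been mixed
only `m - 1 - q` times. -/
lemma eq_sum_mix_pow (h0 : Z 0 = 0) (hZ : ∀ m, Z (m + 1) = mix P (Z m) + g m) (m : ℕ) :
    Z m = fun j => ∑ q ∈ Finset.range m, mix (P ^ (m - 1 - q)) (g q) j := by
  induction m with
  | zero => rw [h0]; funext j; simp
  | succ m ih =>
    rw [hZ, ih, mix_sum]
    funext j
    rw [Pi.add_apply, Finset.sum_range_succ]
    congr 1
    · refine Finset.sum_congr rfl fun q hq => ?_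
      rw [mix_mix, ← pow_succ', show m - 1 - q + 1 = m + 1 - 1 - q by
        have := Finset.mem_range.1 hq; omega]
    · simp [mix, Matrix.one_apply]

lemma mean_eq_sum_mean (hP : P ∈ doublyStochastic ℝ (Fin n)) (h0 : Z 0 = 0)
    (hZ : ∀ m, Z (m + 1) = mix P (Z m) + g m) (m : ℕ) :
    mean (Z m) = ∑ q ∈ Finset.range m, mean (g q) := by
  induction m with
  | zero => simp [h0, mean]
  | succ m ih =>
    rw [hZ, Finset.sum_range_succ, ← ih]
    exact (mean_add _ _).trans (by rw [mean_mix hP])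

/-- The sequence that is in consensus at time `s` and follows the recursion of `Z` from then on
differs from `Z` only in the contribution of the terms before `s`. -/
lemma sub_eq_sum_mix_pow (hP : P ∈ doublyStochastic ℝ (Fin n)) (h0 : Z 0 = 0)
    (hZ : ∀ m, Z (m + 1) = mix P (Z m) + g m) (s : ℕ) {u : ℕ → Fin n → F}
    (hu0 : u 0 = fun _ => mean (Z s)) (hu : ∀ r, u (r + 1) = mix P (u r) + g (s + r)) (r : ℕ)
    (j : Fin n) :
    Z (s + r) j - u r j
      = ∑ q ∈ Finset.range s, ∑ l, ((P ^ (s + r - 1 - q)) j l - 1 / n) • g q l := by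
  induction r generalizing j with
  | zero =>
    rw [hu0, mean_eq_sum_mean hP h0 hZ, add_zero, eq_sum_mix_pow h0 hZ s]
    simp only [mix, mean, sub_smul, Finset.sum_sub_distrib, Finset.smul_sum]
  | succ r ih =>
    have hdiff : Z (s + (r + 1)) j - u (r + 1) j = ∑ k, P j k • (Z (s + r) k - u r k) := by
      rw [← add_assoc, hZ, hu]
      simp [mix, smul_sub]
    rw [hdiff]
    simp only [ih, Finset.smul_sum]
    rw [Finset.sum_comm]
    refine Finset.sum_congr rfl fun q hq => ?_
    rw [Finset.sum_comm]
    refine Finset.sum_congr rfl fun l _ => ?_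
    simp only [smul_smul]
    rw [← Finset.sum_smul, show s + (r + 1) - 1 - q = s + r - 1 - q + 1 by
      have := Finset.mem_range.1 hq; omega, pow_succ', Matrix.mul_apply]
    simp only [mul_sub, Finset.sum_sub_distrib, ← Finset.sum_mul,
      (mem_doublyStochastic_iff_sum.1 hP).2.1 j, one_mul]

end Module

end Network

/-! ### The Jensen gap as a potential for the disagreement of the nodes. -/

section Gap

variable {E : Type*} [NormedAddCommGroup E] [NormedSpace ℝ E]
variable {X : Set E} {ψ : E → ℝ} {a : ℝ} {n : ℕ} {P : Matrix (Fin n) (Fin n) ℝ}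

/-- The Jensen gap of the conjugate over the dual variables of the nodes. -/
def jensenGap (X : Set E) (ψ : E → ℝ) (a : ℝ) (v : Fin n → StrongDual ℝ E) : ℝ :=
  (1 / (n : ℝ)) * ∑ j, conjugate X ψ a (v j) - conjugate X ψ a (mean v)

/-- The root mean square distance of the projections to the projection of the mean. -/
def spread (X : Set E) (ψ : E → ℝ) (a : ℝ) (v : Fin n → StrongDual ℝ E) : ℝ :=
  rms fun j => ‖proxPoint X ψ a (v j) - proxPoint X ψ a (mean v)‖

lemma jensenGap_const (hn : 0 < n) (c : StrongDual ℝ E) :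
    jensenGap X ψ a (fun _ : Fin n => c) = 0 := by
  have : (n : ℝ) ≠ 0 := Nat.cast_ne_zero.2 hn.ne'
  simp [jensenGap, mean_const hn, this]

variable [FiniteDimensional ℝ E]

/-- Average the co-coercivity inequality based at the mean over the nodes; the linear terms cancel.
-/
lemma sq_spread_le (hX : IsClosed X) (hX0 : (0 : E) ∈ X) (hψ : IsProximal X ψ) (ha : 0 < a)
    (hn : 0 < n) (v : Fin n → StrongDual ℝ E) :
    spread X ψ a v ^ 2 ≤ 2 * a * jensenGap X ψ a v := by
  have hn' : (n : ℝ) ≠ 0 := Nat.cast_ne_zero.2 hn.ne'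
  have h := Finset.sum_le_sum fun (j : Fin n) (_ : j ∈ Finset.univ) =>
    conjugate_add_le hX hX0 hψ ha (mean v) (v j)
  have h0 : ∑ j, (v j - mean v) (proxPoint X ψ a (mean v)) = 0 := by
    rw [← sum_apply, Finset.sum_sub_distrib]
    have : ∑ _j : Fin n, mean v = ∑ j, v j := by
      simp [mean, ← Nat.cast_smul_eq_nsmul ℝ, smul_smul, hn']
    rw [this, sub_self, zero_apply]
  rw [Finset.sum_add_distrib, Finset.sum_sub_distrib, h0, ← Finset.mul_sum] at h
  simp only [Finset.sum_const, Finset.card_univ, Fintype.card_fin, nsmul_eq_mul, sub_zero] at h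
  rw [spread, sq_rms, jensenGap]
  set S := ∑ j, ‖proxPoint X ψ a (v j) - proxPoint X ψ a (mean v)‖ ^ 2
  have h1 : 1 / (n : ℝ) * S = 2 * a * ((1 / n) * (1 / (2 * a) * S)) := by field_simp
  rw [h1]
  refine mul_le_mul_of_nonneg_left ?_ (by positivity)
  have h2 := mul_le_mul_of_nonneg_left h (show (0 : ℝ) ≤ 1 / n by positivity)
  rw [mul_add, ← mul_assoc (1 / (n : ℝ)) n, one_div_mul_cancel hn', one_mul] at h2
  linarith

lemma jensenGap_nonneg (hX : IsClosed X) (hX0 : (0 : E) ∈ X) (hψ : IsProximal X ψ) (ha : 0 < a)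
    (hn : 0 < n) (v : Fin n → StrongDual ℝ E) : 0 ≤ jensenGap X ψ a v := by
  have h := (sq_nonneg _).trans (sq_spread_le hX hX0 hψ ha hn v)
  exact nonneg_of_mul_nonneg_right h (by positivity)

/-- Unit row sums give Jensen's inequality at each node, while unit column sums preserve both the
mean and the total of the bounds. -/
lemma jensenGap_mix_le (hX : IsClosed X) (hX0 : (0 : E) ∈ X) (hψ : IsProximal X ψ) (ha : 0 < a)
    (hP : P ∈ doublyStochastic ℝ (Fin n)) (v : Fin n → StrongDual ℝ E) :
    jensenGap X ψ a (mix P v) ≤ jensenGap X ψ a v := by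
  obtain ⟨hP0, hPr, hPc⟩ := mem_doublyStochastic_iff_sum.1 hP
  unfold jensenGap
  rw [mean_mix hP]
  refine sub_le_sub_right (mul_le_mul_of_nonneg_left ?_ (by positivity)) _
  have hj : ∀ j, conjugate X ψ a (mix P v j) ≤ ∑ k, P j k * conjugate X ψ a (v k) := by
    intro j
    have h := Finset.sum_le_sum fun (k : Fin n) (_ : k ∈ Finset.univ) =>
      mul_le_mul_of_nonneg_left ((le_add_of_nonneg_right (by positivity)).trans
        (conjugate_add_le hX hX0 hψ ha (mix P v j) (v k))) (hP0 j k)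
    have h0 : ∑ k, P j k * (v k - mix P v j) (proxPoint X ψ a (mix P v j)) = 0 := by
      have : ∑ k, P j k • (v k - mix P v j) = 0 := by
        simp only [smul_sub, Finset.sum_sub_distrib, ← Finset.sum_smul, hPr j, one_smul]
        exact sub_self _
      have h1 := congrArg (fun w : StrongDual ℝ E => w (proxPoint X ψ a (mix P v j))) this
      simpa [sum_apply] using h1
    simp only [mul_sub] at h
    rw [Finset.sum_sub_distrib, h0, ← Finset.sum_mul, hPr j] at h
    linarith
  refine (Finset.sum_le_sum fun j _ => hj j).trans (le_of_eq ?_)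
  rw [Finset.sum_comm]
  refine Finset.sum_congr rfl fun k _ => ?_
  rw [← Finset.sum_mul, hPc k, one_mul]

/-- Smoothness at the nodes and convexity at the mean leave a cross term bounded by `rms` times
`spread`. With `spread ≤ 2√γ√(a/2)`, where `γ` is the old gap, the bound becomes a perfect square.
-/
lemma sqrt_jensenGap_add_le (hX : IsClosed X) (hX0 : (0 : E) ∈ X) (hψ : IsProximal X ψ)
    (ha : 0 < a) (hn : 0 < n) (v g : Fin n → StrongDual ℝ E) :
    √(jensenGap X ψ a (v + g)) ≤ √(jensenGap X ψ a v) + √(a / 2) * rms fun j => ‖g j‖ := by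
  have hn' : (0 : ℝ) ≤ 1 / n := by positivity
  set γ := jensenGap X ψ a v with hγ
  have hγ0 : 0 ≤ γ := jensenGap_nonneg hX hX0 hψ ha hn v
  have h1 := mul_le_mul_of_nonneg_left (Finset.sum_le_sum fun (j : Fin n) (_ : j ∈ Finset.univ) =>
    conjugate_add_smooth hX hX0 hψ ha (v j) (g j)) hn'
  rw [Finset.sum_add_distrib, Finset.sum_sub_distrib, ← Finset.mul_sum] at h1
  have h2 := (le_add_of_nonneg_right (by positivity)).trans
    (conjugate_add_le hX hX0 hψ ha (mean v) (mean (v + g)))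
  have h3 : mean (v + g) - mean v = mean g := by
    rw [show mean (v + g) = mean v + mean g from mean_add v g, add_sub_cancel_left]
  rw [h3] at h2
  have h4 : mean g (proxPoint X ψ a (mean v)) - (1 / n) * ∑ j, g j (proxPoint X ψ a (v j))
      = (1 / n) * ∑ j, g j (proxPoint X ψ a (mean v) - proxPoint X ψ a (v j)) := by
    simp [mean, sum_apply, mul_sub]
  have h5 : (1 / n) * ∑ j, g j (proxPoint X ψ a (mean v) - proxPoint X ψ a (v j))
      ≤ (rms fun j => ‖g j‖) * spread X ψ a v := by
    refine le_trans (mul_le_mul_of_nonneg_left (Finset.sum_le_sum fun j _ => ?_) hn')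
      (mean_mul_le_rms_mul_rms _ _)
    rw [norm_sub_rev (proxPoint X ψ a (v j))]
    exact (le_abs_self _).trans ((g j).le_opNorm _)
  have h6 : spread X ψ a v ≤ 2 * (√γ * √(a / 2)) := by
    refine le_of_sq_le_sq ?_ (by positivity)
    rw [mul_pow, mul_pow, Real.sq_sqrt hγ0, Real.sq_sqrt (by positivity)]
    linarith [sq_spread_le hX hX0 hψ ha hn v]
  have h7 : jensenGap X ψ a (v + g) ≤ (√γ + √(a / 2) * rms fun j => ‖g j‖) ^ 2 := by
    have h8 : (√γ + √(a / 2) * rms fun j => ‖g j‖) ^ 2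
        = γ + 2 * (√γ * √(a / 2)) * (rms fun j => ‖g j‖)
          + a / 2 * ((1 / n) * ∑ j, ‖g j‖ ^ 2) := by
      rw [add_sq, mul_pow, Real.sq_sqrt hγ0, Real.sq_sqrt (by positivity), sq_rms]
      ring
    have h9 := mul_le_mul_of_nonneg_left h6 (rms_nonneg fun j => ‖g j‖)
    have h10 : γ = (1 / (n : ℝ)) * ∑ j, conjugate X ψ a (v j) - conjugate X ψ a (mean v) := rfl
    have h11 : jensenGap X ψ a (v + g)
        = (1 / (n : ℝ)) * ∑ j, conjugate X ψ a (v j + g j) - conjugate X ψ a (mean (v + g)) := rfl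
    rw [h8, h11]
    simp only [mul_add, mul_sub] at h1
    linarith
  exact Real.sqrt_le_iff.2 ⟨add_nonneg (Real.sqrt_nonneg _)
    (mul_nonneg (Real.sqrt_nonneg _) (rms_nonneg _)), h7⟩

/-- Starting from consensus, every round of averaging and adding vectors increases the mean distance
of the projections to the projection of the mean by at most `a` times the size of the vectors. -/
lemma mean_norm_proxPoint_sub_le (hX : IsClosed X) (hX0 : (0 : E) ∈ X) (hψ : IsProximal X ψ)
    (ha : 0 < a) (hn : 0 < n) (hP : P ∈ doublyStochastic ℝ (Fin n))
    {u h : ℕ → Fin n → StrongDual ℝ E} {c : StrongDual ℝ E} (hu0 : u 0 = fun _ => c)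
    (hu : ∀ r, u (r + 1) = mix P (u r) + h r) (r : ℕ) :
    (1 / (n : ℝ)) * ∑ j, ‖proxPoint X ψ a (u r j) - proxPoint X ψ a (mean (u r))‖
      ≤ a * ∑ q ∈ Finset.range r, rms fun j => ‖h q j‖ := by
  have hgap : √(jensenGap X ψ a (u r))
      ≤ √(a / 2) * ∑ q ∈ Finset.range r, rms fun j => ‖h q j‖ := by
    induction r with
    | zero => rw [hu0, jensenGap_const hn]; simp
    | succ r ih =>
      rw [hu, Finset.sum_range_succ, mul_add]
      refine (sqrt_jensenGap_add_le hX hX0 hψ ha hn _ _).trans (add_le_add_left ?_ _)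
      exact (Real.sqrt_le_sqrt (jensenGap_mix_le hX hX0 hψ ha hP _)).trans ih
  -- The constants combine to exactly `a`: `spread² ≤ 2a · gap` and `gap ≤ (a/2)(∑ rms)²`.
  refine (mean_le_rms _).trans ?_
  have h0 : 0 ≤ ∑ q ∈ Finset.range r, rms fun j => ‖h q j‖ :=
    Finset.sum_nonneg fun q _ => rms_nonneg _
  have hsp := sq_spread_le hX hX0 hψ ha hn (u r)
  have h1 : jensenGap X ψ a (u r)
      ≤ a / 2 * (∑ q ∈ Finset.range r, rms fun j => ‖h q j‖) ^ 2 := by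
    have := pow_le_pow_left₀ (Real.sqrt_nonneg _) hgap 2
    rwa [Real.sq_sqrt (jensenGap_nonneg hX hX0 hψ ha hn _), mul_pow,
      Real.sq_sqrt (by positivity)] at this
  refine le_of_sq_le_sq (a := spread X ψ a (u r)) (hsp.trans ?_) (by positivity)
  calc _ ≤ 2 * a * (a / 2 * (∑ q ∈ Finset.range r, rms fun j => ‖h q j‖) ^ 2) :=
        mul_le_mul_of_nonneg_left h1 (by positivity)
    _ = _ := by ring

end Gap

/-! ### The network error and the deterministic regret of a node. -/

section NetworkError

variable {n : ℕ} {P : Matrix (Fin n) (Fin n) ℝ}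

/-- Bound for the distance of the dual variables of nodes `i` and `j` at time `m`, in terms of the
norms `e q l` of the vectors received by node `l` in round `q` and their root mean squares `ρ q`;
only the last `K` rounds are far from consensus. -/
def pairError (P : Matrix (Fin n) (Fin n) ℝ) (K T : ℕ) (e : ℕ → Fin n → ℝ) (ρ : ℕ → ℝ)
    (i j : Fin n) (m : ℕ) : ℝ :=
  ∑ q ∈ Finset.Ico (m - K) m, ∑ l, |(P ^ (m - 1 - q)) i l - (P ^ (m - 1 - q)) j l| * e q l
    + 2 / T * ∑ q ∈ Finset.range (m - K), ρ q

/-- Bound for the mean distance to the central projection at time `m`. -/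
def centerError (K T : ℕ) (ρ : ℕ → ℝ) (m : ℕ) : ℝ :=
  ∑ q ∈ Finset.Ico (m - K) m, ρ q + 1 / T * ∑ q ∈ Finset.range (m - K), ρ q

/-- Bound for the network error of node `i` at time `m`. -/
def networkError (P : Matrix (Fin n) (Fin n) ℝ) (K T : ℕ) (e : ℕ → Fin n → ℝ) (ρ : ℕ → ℝ)
    (i : Fin n) (m : ℕ) : ℝ :=
  (1 / (n : ℝ)) * ∑ j, pairError P K T e ρ i j m + centerError K T ρ m

section Recursion

variable {F : Type*} [NormedAddCommGroup F]

lemma sum_abs_pow_sub_mul_norm_le (hP : P ∈ doublyStochastic ℝ (Fin n)) (hgap : sigma2 P < 1)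
    {K T k : ℕ} (hK : √n * sigma2 P ^ K ≤ 1 / T) (hk : K ≤ k) (i : Fin n) (v : Fin n → F) :
    ∑ l, |(P ^ k) i l - 1 / n| * ‖v l‖ ≤ 1 / T * rms fun l => ‖v l‖ := by
  refine (sum_abs_pow_sub_mul_le hP hgap i k _).trans
    (mul_le_mul_of_nonneg_right (le_trans ?_ hK) (rms_nonneg _))
  exact mul_le_mul_of_nonneg_left (pow_le_pow_of_le_one (sigma2_nonneg P) hgap.le hk)
    (Real.sqrt_nonneg _)

variable [NormedSpace ℝ F] {Z g : ℕ → Fin n → F}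

lemma norm_sum_smul_le (c : Fin n → ℝ) (v : Fin n → F) :
    ‖∑ l, c l • v l‖ ≤ ∑ l, |c l| * ‖v l‖ :=
  (norm_sum_le _ _).trans (Finset.sum_le_sum fun l _ => by rw [norm_smul, Real.norm_eq_abs])

/-- For rounds older than `K`, both rows are compared with the uniform distribution, each at cost
`1/T`. The recent rounds keep their exact weights, so that the bound stays linear in the norms and
can be averaged over the randomness. -/
lemma norm_sub_le_pairError (hP : P ∈ doublyStochastic ℝ (Fin n)) (hgap : sigma2 P < 1)
    {K T : ℕ} (hK : √n * sigma2 P ^ K ≤ 1 / T)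
    (h0 : Z 0 = 0) (hZ : ∀ m, Z (m + 1) = mix P (Z m) + g m) (i j : Fin n) (m : ℕ) :
    ‖Z m i - Z m j‖
      ≤ pairError P K T (fun q l => ‖g q l‖) (fun q => rms fun l => ‖g q l‖) i j m := by
  have hformula : Z m i - Z m j
      = ∑ q ∈ Finset.range m,
          ∑ l, ((P ^ (m - 1 - q)) i l - (P ^ (m - 1 - q)) j l) • g q l := by
    rw [eq_sum_mix_pow h0 hZ m]
    simp only [mix, sub_smul, Finset.sum_sub_distrib]
  rw [hformula]
  refine (norm_sum_le _ _).trans ((Finset.sum_le_sum fun q _ => norm_sum_smul_le _ _).trans ?_)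
  rw [← Finset.sum_range_add_sum_Ico _ (Nat.sub_le m K), add_comm, pairError, Finset.mul_sum]
  refine add_le_add_right (Finset.sum_le_sum fun q hq => ?_) _
  have hk : K ≤ m - 1 - q := by have := Finset.mem_range.1 hq; omega
  have h1 := sum_abs_pow_sub_mul_norm_le hP hgap hK hk i (g q)
  have h2 := sum_abs_pow_sub_mul_norm_le hP hgap hK hk j (g q)
  calc ∑ l, |(P ^ (m - 1 - q)) i l - (P ^ (m - 1 - q)) j l| * ‖g q l‖
      ≤ ∑ l, (|(P ^ (m - 1 - q)) i l - 1 / n| * ‖g q l‖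
          + |(P ^ (m - 1 - q)) j l - 1 / n| * ‖g q l‖) := by
        refine Finset.sum_le_sum fun l _ => ?_
        rw [← add_mul]
        refine mul_le_mul_of_nonneg_right ?_ (norm_nonneg _)
        have := abs_sub_le ((P ^ (m - 1 - q)) i l) (1 / n) ((P ^ (m - 1 - q)) j l)
        rwa [abs_sub_comm (1 / (n : ℝ))] at this
    _ ≤ 2 / T * rms fun l => ‖g q l‖ := by
        rw [Finset.sum_add_distrib]
        have : 2 / (T : ℝ) = 1 / T + 1 / T := by ring
        rw [this]; linarith

end Recursion

variable {E : Type*} [NormedAddCommGroup E] [NormedSpace ℝ E] {X : Set E} {ψ : E → ℝ}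

/-- The error of one round. -/
lemma objective_sub_le (hn : 0 < n) {L : ℝ≥0} {f : Fin n → E → ℝ}
    (hf : ∀ j, LipschitzOnWith L (f j) X) {x : Fin n → E} (hx : ∀ j, x j ∈ X)
    {s : Fin n → StrongDual ℝ E} (hs : ∀ j, s j ∈ subdifferential (f j) (x j))
    (hsL : ∀ j, ‖s j‖ ≤ L) (y xs : E) (i : Fin n) :
    objective f (x i) - objective f xs
      ≤ L * ((1 / (n : ℝ)) * ∑ j, ‖x i - x j‖) + L * ((1 / (n : ℝ)) * ∑ j, ‖x j - y‖)
        + mean s (y - xs) := by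
  have hj : ∀ j, f j (x i) - f j xs
      ≤ L * ‖x i - x j‖ + L * ‖x j - y‖ + s j (y - xs) := by
    intro j
    have h1 : f j (x i) - f j (x j) ≤ L * ‖x i - x j‖ := by
      have := (hf j).dist_le_mul _ (hx i) _ (hx j)
      rw [Real.dist_eq, dist_eq_norm] at this
      exact (le_abs_self _).trans this
    have h2 := hs j xs
    have h3 : s j (x j - y) ≤ L * ‖x j - y‖ :=
      (le_abs_self _).trans (((s j).le_opNorm _).trans
        (mul_le_mul_of_nonneg_right (hsL j) (norm_nonneg _)))
    simp only [map_sub] at h2 h3 ⊢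
    linarith
  have h := mul_le_mul_of_nonneg_left (Finset.sum_le_sum fun j (_ : j ∈ Finset.univ) => hj j)
    (show (0 : ℝ) ≤ 1 / n by positivity)
  simp only [Finset.sum_add_distrib, Finset.sum_sub_distrib, ← Finset.mul_sum] at h
  have h4 : mean s (y - xs) = (1 / (n : ℝ)) * ∑ j, s j (y - xs) := by
    simp [mean, sum_apply]
  rw [h4, objective, objective]
  linarith

lemma objective_runningAverage_sub_le {f : Fin n → E → ℝ}
    (hf : ∀ j, ConvexOn ℝ univ (f j)) {T : ℕ} (hT : 1 ≤ T) (x : ℕ → E) (xs : E) :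
    T * (objective f (runningAverage x T) - objective f xs)
      ≤ ∑ m ∈ Finset.range T, (objective f (x (m + 1)) - objective f xs) := by
  have hT' : (0 : ℝ) < T := Nat.cast_pos.2 hT
  have hconv : ConvexOn ℝ univ (objective f) := by
    have h : ConvexOn ℝ univ (fun y => ∑ i, f i y) := by
      refine ⟨convex_univ, fun u _ v _ a b ha hb hab => ?_⟩
      rw [Finset.smul_sum, Finset.smul_sum, ← Finset.sum_add_distrib]
      exact Finset.sum_le_sum fun j _ => (hf j).2 (mem_univ _) (mem_univ _) ha hb hab
    exact h.smul (show (0 : ℝ) ≤ 1 / n by positivity)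
  have h := hconv.map_sum_le (t := Finset.Icc 1 T) (w := fun _ => 1 / (T : ℝ)) (p := x)
    (fun _ _ => by positivity) (by simp [hT'.ne']) (fun _ _ => mem_univ _)
  rw [← Finset.smul_sum] at h
  have h1 : ∑ t ∈ Finset.Icc 1 T, objective f (x t)
      = ∑ m ∈ Finset.range T, objective f (x (m + 1)) := by
    rw [Finset.range_eq_Ico, Finset.sum_Ico_add' (fun t => objective f (x t)) 0 T 1]
    rfl
  rw [← Finset.smul_sum, h1, smul_eq_mul, one_div_mul_eq_div, le_div_iff₀ hT'] at h
  rw [Finset.sum_sub_distrib, Finset.sum_const, Finset.card_range, nsmul_eq_mul, mul_sub]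
  rw [runningAverage]
  linarith

variable [FiniteDimensional ℝ E]

/-- The iteration from consensus at time `s`. -/
def restart {F : Type*} [AddCommGroup F] [Module ℝ F] (P : Matrix (Fin n) (Fin n) ℝ) (c : F)
    (h : ℕ → Fin n → F) : ℕ → Fin n → F
  | 0 => fun _ => c
  | r + 1 => mix P (restart P c h r) + h r

/-- The restarted process `u` has the same mean as `Z`. Its distance to the center is controlled by
the Jensen gap over the recent rounds; its distance to `Z` comes only from older vectors, which
mixing has damped. -/
lemma mean_norm_sub_le_centerError (hX : IsClosed X) (hX0 : (0 : E) ∈ X) (hψ : IsProximal X ψ)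
    {a : ℝ} (ha : 0 < a) (hn : 0 < n) (hP : P ∈ doublyStochastic ℝ (Fin n))
    (hgap : sigma2 P < 1) {K T : ℕ} (hK : √n * sigma2 P ^ K ≤ 1 / T)
    {Z g : ℕ → Fin n → StrongDual ℝ E} (h0 : Z 0 = 0)
    (hZ : ∀ m, Z (m + 1) = mix P (Z m) + g m) (m : ℕ) :
    (1 / (n : ℝ)) * ∑ j, ‖proxPoint X ψ a (Z m j) - proxPoint X ψ a (mean (Z m))‖
      ≤ a * centerError K T (fun q => rms fun l => ‖g q l‖) m := by
  -- Truncated subtraction covers `m < K`: then `s = 0` and there are no older rounds.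
  obtain ⟨s, r, hs, hm⟩ : ∃ s r, s = m - K ∧ m = s + r :=
    ⟨m - K, m - (m - K), rfl, by omega⟩
  set u := restart P (mean (Z s)) (fun q => g (s + q)) with hu
  have hu0 : u 0 = fun _ => mean (Z s) := rfl
  have hustep : ∀ r, u (r + 1) = mix P (u r) + g (s + r) := fun r => rfl
  have hmean : ∀ r, mean (u r) = mean (Z (s + r)) := by
    intro r
    induction r with
    | zero => rw [hu0, mean_const hn, add_zero]
    | succ r ih =>
      rw [hustep, ← add_assoc, hZ]
      exact (mean_add _ _).trans (by
        rw [mean_mix hP, ih]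
        exact ((mean_add _ _).trans (by rw [mean_mix hP])).symm)
  have hn' : (0 : ℝ) < n := Nat.cast_pos.2 hn
  have h1 := mean_norm_proxPoint_sub_le hX hX0 hψ ha hn hP hu0 hustep r
  rw [hmean, ← hm] at h1
  have h2 : ∀ j, ‖proxPoint X ψ a (Z m j) - proxPoint X ψ a (u r j)‖
      ≤ a * (1 / T * ∑ q ∈ Finset.range s, rms fun l => ‖g q l‖) := by
    intro j
    refine (norm_proxPoint_sub_le hX hX0 hψ ha _ _).trans (mul_le_mul_of_nonneg_left ?_ ha.le)
    rw [hm, sub_eq_sum_mix_pow hP h0 hZ s hu0 hustep r j, Finset.mul_sum]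
    refine (norm_sum_le _ _).trans (Finset.sum_le_sum fun q hq => ?_)
    refine (norm_sum_smul_le _ _).trans (sum_abs_pow_sub_mul_norm_le hP hgap hK ?_ j (g q))
    have := Finset.mem_range.1 hq
    omega
  have h3 : ∑ q ∈ Finset.range r, (rms fun l => ‖g (s + q) l‖)
      = ∑ q ∈ Finset.Ico (m - K) m, rms fun l => ‖g q l‖ := by
    rw [← hs, hm, Finset.sum_Ico_eq_sum_range, add_tsub_cancel_left]
  rw [h3] at h1
  rw [centerError, ← hs]
  have h4 : (1 / (n : ℝ)) * ∑ j, ‖proxPoint X ψ a (Z m j) - proxPoint X ψ a (mean (Z m))‖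
      ≤ (1 / (n : ℝ)) * ∑ j : Fin n, (a * (1 / T * ∑ q ∈ Finset.range s, rms fun l => ‖g q l‖)
        + ‖proxPoint X ψ a (u r j) - proxPoint X ψ a (mean (Z m))‖) := by
    refine mul_le_mul_of_nonneg_left (Finset.sum_le_sum fun j _ => ?_) (by positivity)
    exact (norm_sub_le_norm_sub_add_norm_sub _ (proxPoint X ψ a (u r j)) _).trans
      (add_le_add_left (h2 j) _)
  rw [Finset.sum_add_distrib, mul_add, Finset.sum_const, Finset.card_univ, Fintype.card_fin,
    nsmul_eq_mul, ← mul_assoc, one_div_mul_cancel hn'.ne', one_mul] at h4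
  rw [← hs] at h1
  linarith

/-- The factor 3 is 2 from the pairs and 1 from the center; the `+ 1` collects the older rounds,
fewer than `T` of weight `1/T`. At `m = 0` all sums are empty. The bounds `e`, `ρ` may be norms or
their expectations. -/
lemma networkError_le (hP : P ∈ doublyStochastic ℝ (Fin n)) {K T : ℕ}
    {e : ℕ → Fin n → ℝ} {ρ : ℕ → ℝ} {L : ℝ} (hL : 0 ≤ L) (he : ∀ q l, e q l ≤ L)
    (hρ : ∀ q, ρ q ≤ L) (i : Fin n) {m : ℕ} (hm : m < T) :
    networkError P K T e ρ i m ≤ 3 * L * if m = 0 then 0 else (K + 1 : ℝ) := by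
  have hn : (0 : ℝ) < n := Nat.cast_pos.2 i.pos
  split_ifs with hm0
  · simp [networkError, pairError, centerError, hm0]
  have hT : (0 : ℝ) < T := Nat.cast_pos.2 (by omega)
  have hold : 1 / (T : ℝ) * ∑ q ∈ Finset.range (m - K), ρ q ≤ L := by
    have h1 : ∑ q ∈ Finset.range (m - K), ρ q ≤ T * L := by
      refine (Finset.sum_le_sum fun q _ => hρ q).trans ?_
      rw [Finset.sum_const, Finset.card_range, nsmul_eq_mul]
      exact mul_le_mul_of_nonneg_right (Nat.cast_le.2 (by omega)) hL
    rw [one_div_mul_eq_div, div_le_iff₀ hT]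
    linarith
  have hcard : ((m - (m - K) : ℕ) : ℝ) ≤ K := Nat.cast_le.2 (by omega)
  have hcenter : centerError K T ρ m ≤ L * (K + 1) := by
    have h1 : ∑ q ∈ Finset.Ico (m - K) m, ρ q ≤ K * L := by
      refine (Finset.sum_le_sum fun q _ => hρ q).trans ?_
      rw [Finset.sum_const, Nat.card_Ico, nsmul_eq_mul]
      exact mul_le_mul_of_nonneg_right hcard hL
    rw [centerError]
    linarith
  have hpair : ∀ j, pairError P K T e ρ i j m ≤ 2 * (L * (K + 1)) := by
    intro j
    have h1 : ∑ q ∈ Finset.Ico (m - K) m,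
        ∑ l, |(P ^ (m - 1 - q)) i l - (P ^ (m - 1 - q)) j l| * e q l ≤ K * (2 * L) := by
      refine (Finset.sum_le_sum fun q _ => (?_ : _ ≤ 2 * L)).trans ?_
      · refine (Finset.sum_le_sum fun l _ =>
          mul_le_mul_of_nonneg_left (he q l) (abs_nonneg _)).trans ?_
        rw [← Finset.sum_mul]
        exact mul_le_mul_of_nonneg_right (sum_abs_pow_sub_pow_le hP i j _) hL
      · rw [Finset.sum_const, Nat.card_Ico, nsmul_eq_mul]
        exact mul_le_mul_of_nonneg_right hcard (by positivity)
    rw [pairError, show 2 / (T : ℝ) = 2 * (1 / T) by ring, mul_assoc]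
    linarith
  have hmean : (1 / (n : ℝ)) * ∑ j, pairError P K T e ρ i j m ≤ 2 * (L * (K + 1)) := by
    rw [one_div_mul_eq_div, div_le_iff₀ hn]
    refine (Finset.sum_le_sum fun j _ => hpair j).trans (le_of_eq ?_)
    rw [Finset.sum_const, Finset.card_univ, Fintype.card_fin, nsmul_eq_mul, mul_comm]
  rw [networkError]
  linarith

/-- Regret of node `i`, up to the deviation of the received vectors from subgradients. -/
lemma sum_objective_sub_le (hX : IsClosed X) (hX0 : (0 : E) ∈ X) (hψ : IsProximal X ψ)
    (hn : 0 < n) (hP : P ∈ doublyStochastic ℝ (Fin n))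
    (hgap : sigma2 P < 1) {K T : ℕ} (hK : √n * sigma2 P ^ K ≤ 1 / T)
    {α : ℕ → ℝ} (hα : ∀ t, 0 < α t) (hanti : Antitone α)
    {L : ℝ≥0} {f : Fin n → E → ℝ} (hf : ∀ j, LipschitzOnWith L (f j) X)
    {Z g s : ℕ → Fin n → StrongDual ℝ E} (h0 : Z 0 = 0)
    (hZ : ∀ m, Z (m + 1) = mix P (Z m) + g m)
    (hs : ∀ m j, s m j ∈ subdifferential (f j) (proxPoint X ψ (α m) (Z m j)))
    (hsL : ∀ m j, ‖s m j‖ ≤ L) {xs : E} (hxs : xs ∈ X) (i : Fin n) :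
    ∑ m ∈ Finset.range T,
        (objective f (proxPoint X ψ (α m) (Z m i)) - objective f xs)
      ≤ 1 / α T * ψ xs
        + ∑ m ∈ Finset.range T, α m / 2 * (rms fun j => ‖g m j‖) ^ 2
        + L * ∑ m ∈ Finset.range T, α m *
          networkError P K T (fun q l => ‖g q l‖) (fun q => rms fun l => ‖g q l‖) i m
        - ∑ m ∈ Finset.range T,
          (mean (g m) - mean (s m)) (proxPoint X ψ (α m) (mean (Z m)) - xs) := by
  have hround : ∀ m, objective f (proxPoint X ψ (α m) (Z m i)) - objective f xs
      ≤ L * (α m *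
          networkError P K T (fun q l => ‖g q l‖) (fun q => rms fun l => ‖g q l‖) i m)
        + mean (s m) (proxPoint X ψ (α m) (mean (Z m)) - xs) := by
    intro m
    have h1 := objective_sub_le hn hf (x := fun j => proxPoint X ψ (α m) (Z m j))
      (fun j => (isProjection_proxPoint hX hX0 hψ (hα m) (Z m j)).1) (hs m) (hsL m)
      (proxPoint X ψ (α m) (mean (Z m))) xs i
    have h2 := mean_norm_sub_le_centerError hX hX0 hψ (hα m) hn hP hgap hK h0 hZ m
    have h3 : (1 / (n : ℝ)) * ∑ j, ‖proxPoint X ψ (α m) (Z m i) - proxPoint X ψ (α m) (Z m j)‖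
        ≤ α m * ((1 / (n : ℝ)) * ∑ j, pairError P K T (fun q l => ‖g q l‖)
          (fun q => rms fun l => ‖g q l‖) i j m) := by
      rw [mul_left_comm, Finset.mul_sum _ _ (α m)]
      refine mul_le_mul_of_nonneg_left (Finset.sum_le_sum fun j _ => ?_)
        (one_div_nonneg.2 n.cast_nonneg)
      exact (norm_proxPoint_sub_le hX hX0 hψ (hα m) _ _).trans
        (mul_le_mul_of_nonneg_left (norm_sub_le_pairError hP hgap hK h0 hZ i j m) (hα m).le)
    rw [networkError, mul_add, mul_add]
    exact h1.trans (add_le_add_left (add_le_add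
      (mul_le_mul_of_nonneg_left h3 L.coe_nonneg)
      (mul_le_mul_of_nonneg_left h2 L.coe_nonneg)) _)
  -- Regret is measured with the received means, while the rounds involve the subgradient means `s`;
  -- their difference is the noise term.
  have hreg := dualAveraging_regret hX hX0 hψ hα hanti (fun m => mean (g m)) hxs T
  simp only [← mean_eq_sum_mean hP h0 hZ] at hreg
  have hsq : ∑ m ∈ Finset.range T, α m / 2 * ‖mean (g m)‖ ^ 2
      ≤ ∑ m ∈ Finset.range T, α m / 2 * (rms fun j => ‖g m j‖) ^ 2 := by
    refine Finset.sum_le_sum fun m _ => mul_le_mul_of_nonneg_left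
      (pow_le_pow_left₀ (norm_nonneg _) (le_trans ?_ (mean_le_rms fun j => ‖g m j‖)) 2)
      (div_nonneg (hα m).le zero_le_two)
    rw [mean, norm_smul, Real.norm_of_nonneg (by positivity)]
    exact mul_le_mul_of_nonneg_left (norm_sum_le _ _) (by positivity)
  have hsum := Finset.sum_le_sum fun m (_ : m ∈ Finset.range T) => hround m
  rw [Finset.sum_add_distrib, ← Finset.mul_sum] at hsum
  simp only [sub_apply, Finset.sum_sub_distrib] at *
  linarith

/-- The sum of the stepsize terms is at most `T` times the error bound. -/
lemma le_mul_errorBound {T K : ℕ} (hn : 0 < n) (hT : 1 ≤ T) (hgap : sigma2 P < 1)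
    (hK : (K : ℝ) ≤ Real.log (T * √n) / (1 - sigma2 P) + 1)
    {α : ℕ → ℝ} (hα : ∀ t, 0 < α t) (L ψs : ℝ) :
    1 / α T * ψs + ∑ m ∈ Finset.range T, α m / 2 * L ^ 2
        + L * ∑ m ∈ Finset.range T, α m * (3 * L * if m = 0 then 0 else (K + 1 : ℝ))
      ≤ T * errorBound n T L α ψs (sigma2 P) := by
  have hT' : (0 : ℝ) < T := Nat.cast_pos.2 hT
  set Λ := Real.log (T * √n) / (1 - sigma2 P) with hΛ
  have hΛ0 : 0 ≤ Λ := by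
    refine div_nonneg (Real.log_nonneg ?_) (by linarith)
    have h1 : (1 : ℝ) ≤ T := Nat.one_le_cast.2 hT
    have h2 : (1 : ℝ) ≤ √n := Real.one_le_sqrt.2 (Nat.one_le_cast.2 hn)
    nlinarith
  have e1 : ∑ t ∈ Finset.Icc 1 T, α (t - 1) = ∑ m ∈ Finset.range T, α m := by
    rw [Finset.range_eq_Ico]
    exact (Finset.sum_Ico_add' (fun t => α (t - 1)) 0 T 1).symm
  -- The vanishing error of the first round is what allows `α(t)` instead of `α(t-1)` next to the
  -- logarithm.
  have e2 : ∑ m ∈ Finset.range T, (if m = 0 then 0 else α m) ≤ ∑ t ∈ Finset.Icc 1 T, α t := by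
    simp only [← ite_not (_ = 0)]
    rw [← Finset.sum_filter]
    refine Finset.sum_le_sum_of_subset_of_nonneg (fun m hm => ?_) fun m _ _ => (hα m).le
    simp only [Finset.mem_filter, Finset.mem_range, Finset.mem_Icc] at *
    omega
  have e3 : ∑ m ∈ Finset.range T, (if m = 0 then 0 else α m) ≤ ∑ m ∈ Finset.range T, α m :=
    Finset.sum_le_sum fun m _ => by split_ifs; exacts [(hα m).le, le_rfl]
  have e4 : ∑ m ∈ Finset.range T, α m * (3 * L * if m = 0 then 0 else (K + 1 : ℝ))
      = 3 * L * (K + 1) * ∑ m ∈ Finset.range T, (if m = 0 then 0 else α m) := by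
    rw [Finset.mul_sum]
    refine Finset.sum_congr rfl fun m _ => ?_
    split_ifs <;> ring
  have e5 : ∑ m ∈ Finset.range T, α m / 2 * L ^ 2
      = L ^ 2 / 2 * ∑ m ∈ Finset.range T, α m := by
    rw [Finset.mul_sum]
    exact Finset.sum_congr rfl fun m _ => by ring
  have e6 : T * errorBound n T L α ψs (sigma2 P)
      = 1 / α T * ψs + 8 * L ^ 2 * ∑ m ∈ Finset.range T, α m
        + 3 * L ^ 2 * Λ * ∑ t ∈ Finset.Icc 1 T, α t := by
    have := (hα T).ne'
    rw [errorBound, e1, ← hΛ]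
    field_simp
  rw [e4, e5, e6]
  set S := ∑ m ∈ Finset.range T, α m
  set S' := ∑ m ∈ Finset.range T, (if m = 0 then 0 else α m)
  have hS' : 0 ≤ S' := Finset.sum_nonneg fun m _ => by split_ifs; exacts [le_rfl, (hα m).le]
  -- From `K + 1 ≤ Λ + 2`. The surplus `2S`, multiplied by `3L²`, and the regret term `L²S/2` add up
  -- to `6.5 L²S`, within the allowed `8L²S`.
  have h1 : (K + 1) * S' ≤ Λ * ∑ t ∈ Finset.Icc 1 T, α t + 2 * S := by
    have := mul_le_mul_of_nonneg_right hK hS'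
    have := mul_le_mul_of_nonneg_left e2 hΛ0
    linarith
  have h2 := mul_le_mul_of_nonneg_left h1 (show 0 ≤ 3 * L ^ 2 by positivity)
  have h3 : 0 ≤ L ^ 2 * S := mul_nonneg (sq_nonneg L) (hS'.trans e3)
  linarith

end NetworkError

/-! ### Exponential moments and martingale tail bounds. -/

section Concentration

variable {Ω : Type*} {m mΩ : MeasurableSpace Ω} {μ : Measure Ω} [IsProbabilityMeasure μ]

lemma integral_le_of_integral_sq_le {X : Ω → ℝ} (hX : MemLp X 2 μ) {L : ℝ} (hL : 0 ≤ L)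
    (h : ∫ ω, X ω ^ 2 ∂μ ≤ L ^ 2) : ∫ ω, X ω ∂μ ≤ L := by
  have h1 := variance_nonneg X μ
  rw [variance_eq_sub hX] at h1
  have h2 : (∫ ω, X ω ∂μ) ^ 2 ≤ L ^ 2 := by
    simp only [Pi.pow_apply] at h1
    linarith
  exact (le_abs_self _).trans (abs_le_of_sq_le_sq h2 hL)

lemma integral_mul_eq_zero_of_condExp_eq_zero (hm : m ≤ mΩ) {V h : Ω → ℝ}
    (hV : StronglyMeasurable[m] V) {C : ℝ} (hC : ∀ᵐ ω ∂μ, |V ω| ≤ C)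
    (hint : Integrable h μ) (hh : μ[h | m] =ᵐ[μ] 0) : ∫ ω, V ω * h ω ∂μ = 0 := by
  have h1 := condExp_stronglyMeasurable_mul_of_bound hm hV hint C hC
  have h2 : ∫ ω, (μ[V * h | m]) ω ∂μ = ∫ ω, (V * h) ω ∂μ := integral_condExp hm
  simp only [Pi.mul_apply] at h2
  rw [← h2]
  refine integral_eq_zero_of_ae ?_
  filter_upwards [h1, hh] with ω h1 h2
  rw [h1, Pi.mul_apply, h2, Pi.zero_apply, mul_zero]

/-- The sum of the increments `X k`, where `X k` is known at time `k + 1`, bounded by `b`, centered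
and of variance at most `v` given the past: exponential moments. -/
lemma integral_exp_sum_le {ℱ : Filtration ℕ mΩ} {X : ℕ → Ω → ℝ} {b v l : ℝ}
    (hX : ∀ k, StronglyMeasurable[ℱ (k + 1)] (X k))
    (hb : ∀ k, ∀ᵐ ω ∂μ, |X k ω| ≤ b)
    (hmean : ∀ k (V : Ω → ℝ), StronglyMeasurable[ℱ k] V → (∃ C, ∀ᵐ ω ∂μ, |V ω| ≤ C) →
      ∫ ω, V ω * X k ω ∂μ = 0)
    (hvar : ∀ k (V : Ω → ℝ), StronglyMeasurable[ℱ k] V → (∃ C, ∀ᵐ ω ∂μ, |V ω| ≤ C) →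
      (∀ ω, 0 ≤ V ω) → ∫ ω, V ω * X k ω ^ 2 ∂μ ≤ v * ∫ ω, V ω ∂μ)
    (hl : 0 ≤ l) (hlb : l * b ≤ 1) (T : ℕ) :
    ∫ ω, Real.exp (l * ∑ k ∈ Finset.range T, X k ω) ∂μ ≤ Real.exp (T * (l ^ 2 * v)) := by
  have hmeas : ∀ T, StronglyMeasurable[ℱ T]
      fun ω => Real.exp (l * ∑ k ∈ Finset.range T, X k ω) := by
    intro T
    refine Real.continuous_exp.comp_stronglyMeasurable (StronglyMeasurable.const_mul ?_ l)
    refine Finset.stronglyMeasurable_fun_sum _ fun k hk => ?_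
    exact (hX k).mono (ℱ.mono (Finset.mem_range.1 hk))
  have hall : ∀ᵐ ω ∂μ, ∀ k, |X k ω| ≤ b := ae_all_iff.2 hb
  have hbd : ∀ T, ∀ᵐ ω ∂μ, |Real.exp (l * ∑ k ∈ Finset.range T, X k ω)| ≤ Real.exp T := by
    intro T
    filter_upwards [hall] with ω hω
    rw [abs_of_pos (Real.exp_pos _)]
    refine Real.exp_le_exp.2 ?_
    rw [Finset.mul_sum]
    refine (Finset.sum_le_card_nsmul _ _ 1 fun k _ => ?_).trans (by simp)
    exact (mul_le_mul_of_nonneg_left ((le_abs_self _).trans (hω k)) hl).trans hlb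
  induction T with
  | zero => simp
  | succ T ih =>
    -- The exponential of the previous partial sum is a bounded nonnegative weight known at time
    -- `T`, so the weighted mean and variance hypotheses apply to the next increment through `exp u
    -- ≤ 1 + u + u²` for `|u| ≤ 1`.
    set V : Ω → ℝ := fun ω => Real.exp (l * ∑ k ∈ Finset.range T, X k ω) with hV
    have hVint : Integrable V μ :=
      Integrable.of_bound ((hmeas T).mono (ℱ.le T)).aestronglyMeasurable (Real.exp T) (hbd T)
    have hXm := ((hX T).mono (ℱ.le (T + 1))).aestronglyMeasurable (μ := μ)
    have hVX : Integrable (fun ω => V ω * X T ω) μ := hVint.mul_bdd (c := b) hXm (hb T)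
    have hVX2 : Integrable (fun ω => V ω * X T ω ^ 2) μ := by
      refine hVint.mul_bdd (c := b ^ 2) (hXm.pow 2) ?_
      filter_upwards [hb T] with ω hω
      rw [Real.norm_eq_abs, abs_pow]
      exact pow_le_pow_left₀ (abs_nonneg _) hω 2
    have hstep : ∀ᵐ ω ∂μ, Real.exp (l * ∑ k ∈ Finset.range (T + 1), X k ω)
        ≤ V ω + l * (V ω * X T ω) + l ^ 2 * (V ω * X T ω ^ 2) := by
      filter_upwards [hb T] with ω hω
      have h1 : |l * X T ω| ≤ 1 := by
        rw [abs_mul, abs_of_nonneg hl]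
        exact (mul_le_mul_of_nonneg_left hω hl).trans hlb
      have h2 := (abs_le.1 (Real.abs_exp_sub_one_sub_id_le h1)).2
      rw [Finset.sum_range_succ, mul_add, Real.exp_add]
      have h3 := mul_le_mul_of_nonneg_left
        (show Real.exp (l * X T ω) ≤ 1 + l * X T ω + (l * X T ω) ^ 2 by linarith)
        (Real.exp_pos (l * ∑ k ∈ Finset.range T, X k ω)).le
      refine h3.trans (le_of_eq ?_)
      simp only [hV]
      ring
    have hint : Integrable (fun ω => V ω + l * (V ω * X T ω) + l ^ 2 * (V ω * X T ω ^ 2)) μ :=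
      (hVint.add (hVX.const_mul l)).add (hVX2.const_mul _)
    calc _ ≤ ∫ ω, (V ω + l * (V ω * X T ω) + l ^ 2 * (V ω * X T ω ^ 2)) ∂μ := by
          refine integral_mono_ae ?_ hint hstep
          exact Integrable.of_bound ((hmeas (T + 1)).mono (ℱ.le _)).aestronglyMeasurable
            (Real.exp (T + 1 : ℕ)) (hbd (T + 1))
      _ = ∫ ω, V ω ∂μ + l * ∫ ω, V ω * X T ω ∂μ + l ^ 2 * ∫ ω, V ω * X T ω ^ 2 ∂μ := by
          have hadd : Integrable (fun ω => V ω + l * (V ω * X T ω)) μ :=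
            hVint.add (hVX.const_mul l)
          rw [integral_add hadd (hVX2.const_mul _), integral_add hVint (hVX.const_mul l),
            integral_const_mul, integral_const_mul]
      _ ≤ (1 + l ^ 2 * v) * ∫ ω, V ω ∂μ := by
          rw [hmean T V (hmeas T) ⟨_, hbd T⟩]
          have := mul_le_mul_of_nonneg_left
            (hvar T V (hmeas T) ⟨_, hbd T⟩ fun ω => (Real.exp_pos _).le) (sq_nonneg l)
          linarith
      _ ≤ Real.exp (l ^ 2 * v) * Real.exp (T * (l ^ 2 * v)) := by
          refine mul_le_mul ?_ ih (integral_nonneg fun ω => (Real.exp_pos _).le)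
            (Real.exp_pos _).le
          linarith [Real.add_one_le_exp (l ^ 2 * v)]
      _ = _ := by
          rw [← Real.exp_add]
          push_cast
          ring_nf

/-- Chernoff's bound with the exponential moment estimate; both tail inequalities reduce to a choice
of `l`. -/
lemma one_sub_le_real_of_exponent_le {ℱ : Filtration ℕ mΩ} {X : ℕ → Ω → ℝ} {b v l s δ : ℝ}
    (hX : ∀ k, StronglyMeasurable[ℱ (k + 1)] (X k))
    (hb : ∀ k, ∀ᵐ ω ∂μ, |X k ω| ≤ b)
    (hmean : ∀ k (V : Ω → ℝ), StronglyMeasurable[ℱ k] V → (∃ C, ∀ᵐ ω ∂μ, |V ω| ≤ C) →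
      ∫ ω, V ω * X k ω ∂μ = 0)
    (hvar : ∀ k (V : Ω → ℝ), StronglyMeasurable[ℱ k] V → (∃ C, ∀ᵐ ω ∂μ, |V ω| ≤ C) →
      (∀ ω, 0 ≤ V ω) → ∫ ω, V ω * X k ω ^ 2 ∂μ ≤ v * ∫ ω, V ω ∂μ)
    (hl : 0 ≤ l) (hlb : l * b ≤ 1) (T : ℕ) (hδ : 0 < δ)
    (hs : -l * s + T * (l ^ 2 * v) ≤ -Real.log (1 / δ)) :
    1 - δ ≤ μ.real {ω | ∑ k ∈ Finset.range T, X k ω ≤ s} := by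
  have hSmeas : StronglyMeasurable fun ω => ∑ k ∈ Finset.range T, X k ω :=
    Finset.stronglyMeasurable_fun_sum _ fun k _ => (hX k).mono (ℱ.le _)
  have hint : Integrable (fun ω => Real.exp (l * ∑ k ∈ Finset.range T, X k ω)) μ := by
    refine Integrable.of_bound (Real.continuous_exp.comp_stronglyMeasurable
      (hSmeas.const_mul l)).aestronglyMeasurable (Real.exp T) ?_
    filter_upwards [ae_all_iff.2 hb] with ω hω
    rw [Real.norm_eq_abs, abs_of_pos (Real.exp_pos _)]
    refine Real.exp_le_exp.2 ?_
    rw [Finset.mul_sum]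
    refine (Finset.sum_le_card_nsmul _ _ 1 fun k _ => ?_).trans (by simp)
    exact (mul_le_mul_of_nonneg_left ((le_abs_self _).trans (hω k)) hl).trans hlb
  have hch := measure_ge_le_exp_mul_mgf (μ := μ) (X := fun ω => ∑ k ∈ Finset.range T, X k ω)
    s hl hint
  have hmgf : mgf (fun ω => ∑ k ∈ Finset.range T, X k ω) μ l ≤ Real.exp (T * (l ^ 2 * v)) :=
    integral_exp_sum_le hX hb hmean hvar hl hlb T
  have hle : μ.real {ω | s ≤ ∑ k ∈ Finset.range T, X k ω} ≤ δ := by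
    refine hch.trans ((mul_le_mul_of_nonneg_left hmgf (Real.exp_pos _).le).trans ?_)
    rw [← Real.exp_add]
    refine (Real.exp_le_exp.2 hs).trans (le_of_eq ?_)
    rw [one_div, Real.log_inv, neg_neg, Real.exp_log hδ]
  have hms : MeasurableSet {ω | ∑ k ∈ Finset.range T, X k ω ≤ s} :=
    measurableSet_le hSmeas.measurable measurable_const
  have hc := probReal_compl_eq_one_sub (μ := μ) hms
  have hsub : {ω | ∑ k ∈ Finset.range T, X k ω ≤ s}ᶜ
      ⊆ {ω | s ≤ ∑ k ∈ Finset.range T, X k ω} := fun ω hω => by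
    simp only [mem_compl_iff, mem_ofPred_eq, not_le] at hω ⊢
    exact hω.le
  have := measureReal_mono (μ := μ) hsub
  linarith

lemma one_sub_le_real_of_bound {X : ℕ → Ω → ℝ} {b s δ : ℝ}
    (hb : ∀ k, ∀ᵐ ω ∂μ, |X k ω| ≤ b) (T : ℕ) (hδ : 0 < δ) (hs : T * b ≤ s) :
    1 - δ ≤ μ.real {ω | ∑ k ∈ Finset.range T, X k ω ≤ s} := by
  have h : {ω | ∑ k ∈ Finset.range T, X k ω ≤ s} ∈ ae μ := by
    filter_upwards [ae_all_iff.2 hb] with ω hω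
    refine (Finset.sum_le_card_nsmul _ _ b fun k _ => (le_abs_self _).trans (hω k)).trans ?_
    simpa using hs
  have h1 : μ.real {ω | ∑ k ∈ Finset.range T, X k ω ≤ s} = 1 := by
    rw [measureReal_congr (Filter.eventuallyEq_univ.2 h), probReal_univ]
  linarith

/-- Azuma's inequality. -/
lemma one_sub_le_real_azuma {ℱ : Filtration ℕ mΩ} {X : ℕ → Ω → ℝ} {b δ : ℝ}
    (hX : ∀ k, StronglyMeasurable[ℱ (k + 1)] (X k))
    (hb : ∀ k, ∀ᵐ ω ∂μ, |X k ω| ≤ b) (hb0 : 0 ≤ b)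
    (hmean : ∀ k (V : Ω → ℝ), StronglyMeasurable[ℱ k] V → (∃ C, ∀ᵐ ω ∂μ, |V ω| ≤ C) →
      ∫ ω, V ω * X k ω ∂μ = 0)
    {T : ℕ} (hT : 1 ≤ T) (hδ : 0 < δ) (hδ1 : δ < 1) :
    1 - δ ≤ μ.real {ω | ∑ k ∈ Finset.range T, X k ω
      ≤ 4 * b * √(Real.log (1 / δ) * T)} := by
  have hl : 0 < Real.log (1 / δ) := Real.log_pos (by rw [lt_div_iff₀ hδ]; linarith)
  set l := Real.log (1 / δ) with hldef
  have hT' : (0 : ℝ) < T := Nat.cast_pos.2 hT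
  -- The choice `√(log(1/δ)/T)/b` satisfies `l b ≤ 1` only in this case. In the other case `T ≤
  -- √(log(1/δ) T)`, and the trivial bound `T b` suffices.
  by_cases hlT : l ≤ T
  · rcases hb0.eq_or_lt with h0 | h0
    · exact one_sub_le_real_of_bound hb T hδ (by simp [← h0])
    · have hvar : ∀ k (V : Ω → ℝ), StronglyMeasurable[ℱ k] V → (∃ C, ∀ᵐ ω ∂μ, |V ω| ≤ C) →
          (∀ ω, 0 ≤ V ω) → ∫ ω, V ω * X k ω ^ 2 ∂μ ≤ b ^ 2 * ∫ ω, V ω ∂μ := by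
        intro k V hV ⟨C, hC⟩ hV0
        have hVi : Integrable V μ :=
          Integrable.of_bound (hV.mono (ℱ.le k)).aestronglyMeasurable C hC
        rw [← integral_const_mul]
        refine integral_mono_of_nonneg (ae_of_all _ fun ω => mul_nonneg (hV0 ω) (sq_nonneg _))
          (hVi.const_mul _) ?_
        filter_upwards [hb k] with ω hω
        have := pow_le_pow_left₀ (abs_nonneg _) hω 2
        rw [sq_abs] at this
        nlinarith [hV0 ω]
      refine one_sub_le_real_of_exponent_le hX hb hmean hvar (l := √(l / T) / b) (by positivity)
        ?_ T hδ ?_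
      · rw [div_mul_cancel₀ _ h0.ne']
        exact Real.sqrt_le_one.2 ((div_le_one hT').2 hlT)
      · have h1 : √(l / T) * √(l * T) = l := by
          rw [← Real.sqrt_mul (by positivity), show l / T * (l * T) = l ^ 2 by field_simp,
            Real.sqrt_sq hl.le]
        have h2 : (√(l / T) / b) ^ 2 * b ^ 2 = l / T := by
          rw [div_pow, Real.sq_sqrt (by positivity)]; field_simp
        rw [h2, show -(√(l / T) / b) * (4 * b * √(l * T)) = -4 * (√(l / T) * √(l * T)) by
          field_simp, h1, mul_div_cancel₀ _ hT'.ne']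
        linarith
  · refine one_sub_le_real_of_bound hb T hδ ?_
    have h1 : (T : ℝ) ≤ √(l * T) := Real.le_sqrt_of_sq_le (by nlinarith)
    nlinarith [mul_le_mul_of_nonneg_left h1 hb0, mul_nonneg hb0 hT'.le]

/-- A Bernstein inequality for martingales whose conditional variances are at most `b ^ 2 / n`. -/
lemma one_sub_le_real_bernstein {ℱ : Filtration ℕ mΩ} {X : ℕ → Ω → ℝ} {b δ : ℝ} {n : ℕ}
    (hn : 0 < n) (hX : ∀ k, StronglyMeasurable[ℱ (k + 1)] (X k))
    (hb : ∀ k, ∀ᵐ ω ∂μ, |X k ω| ≤ b) (hb0 : 0 ≤ b)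
    (hmean : ∀ k (V : Ω → ℝ), StronglyMeasurable[ℱ k] V → (∃ C, ∀ᵐ ω ∂μ, |V ω| ≤ C) →
      ∫ ω, V ω * X k ω ∂μ = 0)
    (hvar : ∀ k (V : Ω → ℝ), StronglyMeasurable[ℱ k] V → (∃ C, ∀ᵐ ω ∂μ, |V ω| ≤ C) →
      (∀ ω, 0 ≤ V ω) → ∫ ω, V ω * X k ω ^ 2 ∂μ ≤ b ^ 2 / n * ∫ ω, V ω ∂μ)
    {T : ℕ} (hT : 1 ≤ T) (hδ : 0 < δ) (hδ1 : δ < 1) :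
    1 - δ ≤ μ.real {ω | ∑ k ∈ Finset.range T, X k ω
      ≤ 3 / 2 * b * Real.log (1 / δ) + 2 * b * √(Real.log (1 / δ) * (T / n))} := by
  have hl : 0 < Real.log (1 / δ) := Real.log_pos (by rw [lt_div_iff₀ hδ]; linarith)
  set l := Real.log (1 / δ) with hldef
  have hT' : (0 : ℝ) < T := Nat.cast_pos.2 hT
  have hn' : (0 : ℝ) < n := Nat.cast_pos.2 hn
  set r : ℝ := T / n with hr
  have hr0 : 0 < r := by positivity
  rcases hb0.eq_or_lt with h0 | h0
  · exact one_sub_le_real_of_bound hb T hδ (by simp [← h0])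
  -- Here `r = T/n` is the total variance in units of `b²`. The square root term governs small
  -- `log(1/δ)`; beyond `r` the parameter is capped at `1/b`, and the linear term takes over.
  by_cases hlr : l ≤ r
  · refine one_sub_le_real_of_exponent_le hX hb hmean hvar (l := √(l / r) / b) (by positivity)
      ?_ T hδ ?_
    · rw [div_mul_cancel₀ _ h0.ne']
      exact Real.sqrt_le_one.2 ((div_le_one hr0).2 hlr)
    · have h1 : √(l / r) * √(l * r) = l := by
        rw [← Real.sqrt_mul (by positivity), show l / r * (l * r) = l ^ 2 by field_simp,
          Real.sqrt_sq hl.le]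
      have h2 : (T : ℝ) * ((√(l / r) / b) ^ 2 * (b ^ 2 / n)) = l := by
        rw [div_pow, Real.sq_sqrt (by positivity), hr]; field_simp
      have h3 : -(√(l / r) / b) * (3 / 2 * b * l + 2 * b * √(l * r))
          = -(3 / 2 * (√(l / r) * l)) - 2 * (√(l / r) * √(l * r)) := by field_simp; ring
      rw [h2, h3, h1]
      have : 0 ≤ √(l / r) * l := by positivity
      linarith
  · refine one_sub_le_real_of_exponent_le hX hb hmean hvar (l := 1 / b) (by positivity)
      ?_ T hδ ?_
    · rw [one_div_mul_cancel h0.ne']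
    · have h1 : r ≤ √(l * r) := Real.le_sqrt_of_sq_le (by nlinarith)
      have h2 : (T : ℝ) * ((1 / b) ^ 2 * (b ^ 2 / n)) = r := by rw [hr]; field_simp
      have h3 : -(1 / b) * (3 / 2 * b * l + 2 * b * √(l * r)) = -(3 / 2 * l) - 2 * √(l * r) := by
        field_simp; ring
      rw [h2, h3]
      linarith

end Concentration

/-! ### Expectations of linear expressions. -/

section HasMean

variable {Ω : Type*} {mΩ : MeasurableSpace Ω} {μ : Measure Ω}

/-- The function `f` is integrable with integral `c`. -/
def HasMean (μ : Measure Ω) (f : Ω → ℝ) (c : ℝ) : Prop :=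
  Integrable f μ ∧ ∫ ω, f ω ∂μ = c

lemma HasMean.add {f g : Ω → ℝ} {c d : ℝ} (hf : HasMean μ f c) (hg : HasMean μ g d) :
    HasMean μ (fun ω => f ω + g ω) (c + d) :=
  ⟨hf.1.add hg.1, by rw [integral_add hf.1 hg.1, hf.2, hg.2]⟩

lemma HasMean.const_mul {f : Ω → ℝ} {c : ℝ} (a : ℝ) (hf : HasMean μ f c) :
    HasMean μ (fun ω => a * f ω) (a * c) :=
  ⟨hf.1.const_mul a, by rw [integral_const_mul, hf.2]⟩

lemma HasMean.sum {ι : Type*} {s : Finset ι} {f : ι → Ω → ℝ} {c : ι → ℝ}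
    (h : ∀ i, HasMean μ (f i) (c i)) : HasMean μ (fun ω => ∑ i ∈ s, f i ω) (∑ i ∈ s, c i) :=
  ⟨integrable_finsetSum _ fun i _ => (h i).1, by
    rw [integral_finsetSum _ fun i _ => (h i).1]
    exact Finset.sum_congr rfl fun i _ => (h i).2⟩

lemma hasMean_const [IsProbabilityMeasure μ] (c : ℝ) : HasMean μ (fun _ => c) c :=
  ⟨integrable_const c, by simp⟩

lemma hasMean_integral {f : Ω → ℝ} (hf : Integrable f μ) : HasMean μ f (∫ ω, f ω ∂μ) := ⟨hf, rfl⟩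

lemma hasMean_networkError {n K T : ℕ} {P : Matrix (Fin n) (Fin n) ℝ}
    {e : ℕ → Fin n → Ω → ℝ} {ρ : ℕ → Ω → ℝ} {ce : ℕ → Fin n → ℝ} {cρ : ℕ → ℝ}
    (he : ∀ q l, HasMean μ (e q l) (ce q l)) (hρ : ∀ q, HasMean μ (ρ q) (cρ q))
    (i : Fin n) (m : ℕ) :
    HasMean μ (fun ω => networkError P K T (fun q l => e q l ω) (fun q => ρ q ω) i m)
      (networkError P K T ce cρ i m) := by
  unfold networkError pairError centerError
  refine ((HasMean.sum fun j => ?_).const_mul _).add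
    ((HasMean.sum fun q => hρ q).add ((HasMean.sum fun q => hρ q).const_mul _))
  exact (HasMean.sum fun q => HasMean.sum fun l => (he q l).const_mul _).add
    ((HasMean.sum fun q => hρ q).const_mul _)

end HasMean

/-! ### Conditional moments of the received vectors. -/

section Noise

variable {Ω : Type*} {m mΩ : MeasurableSpace Ω} {μ : Measure Ω}
variable {E : Type*} [NormedAddCommGroup E] [NormedSpace ℝ E]

lemma norm_condExp_le_of_condExp_sq_le [IsProbabilityMeasure μ]
    {F : Type*} [NormedAddCommGroup F] [NormedSpace ℝ F]
    [CompleteSpace F] {g : Ω → F} (hg : MemLp g 2 μ) {L : ℝ} (hL : 0 ≤ L)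
    (h : ∀ᵐ ω ∂μ, (μ[fun ω' => ‖g ω'‖ ^ 2 | m]) ω ≤ L ^ 2) :
    ∀ᵐ ω ∂μ, ‖(μ[g | m]) ω‖ ≤ L := by
  have hint : Integrable (fun ω => ‖g ω‖ ^ (2 : ℝ)) μ := by
    simpa only [Real.rpow_two] using hg.integrable_norm_pow two_ne_zero
  have hj := _root_.Integrable.norm_condExp_rpow_le (m := m) one_le_two hint
  simp only [Real.rpow_two] at hj
  filter_upwards [hj, h] with ω h1 h2
  exact le_of_sq_le_sq (h1.trans h2) hL

lemma aestronglyMeasurable_apply {d : Ω → StrongDual ℝ E} {w : Ω → E}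
    (hd : AEStronglyMeasurable d μ) (hw : AEStronglyMeasurable w μ) :
    AEStronglyMeasurable (fun ω => d ω (w ω)) μ :=
  isBoundedBilinearMap_apply.continuous.comp_aestronglyMeasurable (hd.prodMk hw)

lemma integrable_apply {d : Ω → StrongDual ℝ E} {w : Ω → E}
    (hd : MemLp d 2 μ) (hw : MemLp w 2 μ) : Integrable (fun ω => d ω (w ω)) μ :=
  (hd.norm.integrable_mul hw.norm).mono' (aestronglyMeasurable_apply hd.1 hw.1)
    (ae_of_all _ fun ω => (d ω).le_opNorm (w ω))

lemma memLp_sub_condExp {g : Ω → StrongDual ℝ E} (hg : MemLp g 2 μ) :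
    MemLp (fun ω => g ω - (μ[g | m]) ω) 2 μ :=
  hg.sub (hg.condExp one_le_two)

variable [IsProbabilityMeasure μ]

/-- The argument `w`, known to `m`, can be pulled out of the conditional expectation. Square
integrability suffices, as claim (1) allows an unbounded `X`. -/
lemma integral_sub_condExp_apply (hm : m ≤ mΩ) {g : Ω → StrongDual ℝ E} (hg : MemLp g 2 μ)
    {w : Ω → E} (hw : StronglyMeasurable[m] w) (hw2 : MemLp w 2 μ) :
    ∫ ω, (g ω - (μ[g | m]) ω) (w ω) ∂μ = 0 := by
  have h1 := integrable_apply hg hw2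
  have h2 := integrable_apply (hg.condExp (m := m) one_le_two) hw2
  have h3 : μ[fun ω => g ω (w ω) | m] =ᵐ[μ] fun ω => (μ[g | m]) ω (w ω) :=
    condExp_bilin_of_aestronglyMeasurable_left (μ := μ) (m := m)
    (ContinuousLinearMap.id ℝ (StrongDual ℝ E)).flip hw.aestronglyMeasurable h1
    (hg.integrable one_le_two)
  have h4 : ∫ ω, (μ[fun ω => g ω (w ω) | m]) ω ∂μ = ∫ ω, g ω (w ω) ∂μ := integral_condExp hm
  simp only [sub_apply]
  rw [integral_sub h1 h2, ← h4, integral_congr_ae h3]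
  exact sub_self _

variable [FiniteDimensional ℝ E]

/-- Uncorrelatedness concerns fixed vectors, whereas `w` is random. In a basis its coordinates are
bounded and known to `m`, hence act as weights. -/
lemma integral_mul_apply_mul_apply_eq_zero (hm : m ≤ mΩ) {d d' : Ω → StrongDual ℝ E}
    (hd : MemLp d 2 μ) (hd' : MemLp d' 2 μ)
    (h : ∀ u v : E, μ[fun ω => d ω u * d' ω v | m] =ᵐ[μ] 0)
    {w : Ω → E} (hw : StronglyMeasurable[m] w) {R : ℝ} (hR : ∀ ω, ‖w ω‖ ≤ R)
    {V : Ω → ℝ} (hV : StronglyMeasurable[m] V) {C : ℝ} (hC : ∀ᵐ ω ∂μ, |V ω| ≤ C) :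
    ∫ ω, V ω * (d ω (w ω) * d' ω (w ω)) ∂μ = 0 := by
  let b := Module.finBasis ℝ E
  let c : Fin (Module.finrank ℝ E) → StrongDual ℝ E := fun a =>
    LinearMap.toContinuousLinearMap (b.coord a)
  have hexp : ∀ (l : StrongDual ℝ E) (u : E), l u = ∑ a, c a u * l (b a) := by
    intro l u
    calc l u = l (∑ a, b.repr u a • b a) := by rw [b.sum_repr]
      _ = _ := by simp only [map_sum, map_smul]; rfl
  have hcoef : ∀ a a' (V : Ω → ℝ), StronglyMeasurable[m] V →
      StronglyMeasurable[m] fun ω => V ω * (c a (w ω) * c a' (w ω)) := fun a a' V hV =>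
    hV.mul (((c a).continuous.comp_stronglyMeasurable hw).mul
      ((c a').continuous.comp_stronglyMeasurable hw))
  have hbound : ∀ a a', ∀ᵐ ω ∂μ,
      |V ω * (c a (w ω) * c a' (w ω))| ≤ C * ((‖c a‖ * R) * (‖c a'‖ * R)) := by
    intro a a'
    filter_upwards [hC] with ω hω
    have hc : ∀ a, |c a (w ω)| ≤ ‖c a‖ * R := fun a =>
      ((c a).le_opNorm _).trans (mul_le_mul_of_nonneg_left (hR ω) (norm_nonneg _))
    rw [abs_mul, abs_mul]
    have h1 := mul_le_mul (hc a) (hc a') (abs_nonneg _) ((abs_nonneg _).trans (hc a))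
    exact mul_le_mul hω h1 (by positivity) ((abs_nonneg _).trans hω)
  have hint : ∀ u v : E, Integrable (fun ω => d ω u * d' ω v) μ := fun u v =>
    ((ContinuousLinearMap.apply ℝ ℝ u).comp_memLp' hd).integrable_mul
      ((ContinuousLinearMap.apply ℝ ℝ v).comp_memLp' hd')
  have hrw : ∀ ω, V ω * (d ω (w ω) * d' ω (w ω))
      = ∑ a, ∑ a', V ω * (c a (w ω) * c a' (w ω)) * (d ω (b a) * d' ω (b a')) := by
    intro ω
    rw [hexp (d ω) (w ω), hexp (d' ω) (w ω), Finset.sum_mul_sum, Finset.mul_sum]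
    refine Finset.sum_congr rfl fun a _ => ?_
    rw [Finset.mul_sum]
    exact Finset.sum_congr rfl fun a' _ => by ring
  have hterm : ∀ a a', HasMean μ
      (fun ω => V ω * (c a (w ω) * c a' (w ω)) * (d ω (b a) * d' ω (b a'))) 0 := fun a a' =>
    ⟨(hint _ _).bdd_mul ((hcoef a a' V hV).mono hm).aestronglyMeasurable (hbound a a'),
      integral_mul_eq_zero_of_condExp_eq_zero hm (hcoef a a' V hV) (hbound a a') (hint _ _)
        (h _ _)⟩
  simp only [hrw]
  rw [(HasMean.sum fun a => HasMean.sum fun a' => hterm a a').2]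
  simp

/-- The average of `n` conditionally uncorrelated deviations has variance of order `1 / n`. -/
lemma integral_mul_sq_mean_apply_le (hm : m ≤ mΩ) {n : ℕ} (hn : 0 < n)
    {d : Fin n → Ω → StrongDual ℝ E} (hd : ∀ j, MemLp (d j) 2 μ)
    {L R : ℝ} (hL : ∀ j, ∀ᵐ ω ∂μ, ‖d j ω‖ ≤ L) (hL0 : 0 ≤ L)
    (h : ∀ j k, j ≠ k → ∀ u v : E, μ[fun ω => d j ω u * d k ω v | m] =ᵐ[μ] 0)
    {w : Ω → E} (hw : StronglyMeasurable[m] w) (hR : ∀ ω, ‖w ω‖ ≤ R)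
    {V : Ω → ℝ} (hV : StronglyMeasurable[m] V) {C : ℝ} (hC : ∀ᵐ ω ∂μ, |V ω| ≤ C)
    (hV0 : ∀ ω, 0 ≤ V ω) :
    ∫ ω, V ω * (mean (fun j => d j ω) (w ω)) ^ 2 ∂μ ≤ (L * R) ^ 2 / n * ∫ ω, V ω ∂μ := by
  have hn' : (0 : ℝ) < n := Nat.cast_pos.2 hn
  have hVi : Integrable V μ := Integrable.of_bound (hV.mono hm).aestronglyMeasurable C hC
  have hdw : ∀ j, ∀ᵐ ω ∂μ, |d j ω (w ω)| ≤ L * R := by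
    intro j
    filter_upwards [hL j] with ω hω
    exact ((d j ω).le_opNorm _).trans (mul_le_mul hω (hR ω) (norm_nonneg _) hL0)
  have hdm : ∀ j, AEStronglyMeasurable (fun ω => d j ω (w ω)) μ := fun j =>
    aestronglyMeasurable_apply (hd j).1 (hw.mono hm).aestronglyMeasurable
  have hint : ∀ j k, Integrable (fun ω => V ω * (d j ω (w ω) * d k ω (w ω))) μ := by
    intro j k
    refine hVi.mul_bdd (c := L * R * (L * R)) ((hdm j).mul (hdm k)) ?_
    filter_upwards [hdw j, hdw k] with ω h1 h2
    rw [Real.norm_eq_abs, abs_mul]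
    exact mul_le_mul h1 h2 (abs_nonneg _) ((abs_nonneg _).trans h1)
  have hrw : ∀ ω, V ω * (mean (fun j => d j ω) (w ω)) ^ 2
      = (1 / (n : ℝ)) ^ 2 * ∑ j, ∑ k, V ω * (d j ω (w ω) * d k ω (w ω)) := by
    intro ω
    simp only [mean, smul_apply, sum_apply, smul_eq_mul, ← Finset.mul_sum]
    rw [mul_pow, sq (∑ j, d j ω (w ω)), Finset.sum_mul_sum]
    simp only [← Finset.mul_sum]
    ring
  have hjk : ∀ j k, ∫ ω, V ω * (d j ω (w ω) * d k ω (w ω)) ∂μ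
      ≤ if j = k then (L * R) ^ 2 * ∫ ω, V ω ∂μ else 0 := by
    intro j k
    split_ifs with hjk
    · subst hjk
      rw [← integral_const_mul]
      refine integral_mono_ae (hint j j) (hVi.const_mul _) ?_
      filter_upwards [hdw j] with ω hω
      have h1 := pow_le_pow_left₀ (abs_nonneg _) hω 2
      rw [sq_abs] at h1
      nlinarith [hV0 ω]
    · exact (integral_mul_apply_mul_apply_eq_zero hm (hd j) (hd k) (h j k hjk) hw hR hV hC).le
  simp only [hrw]
  rw [((HasMean.sum fun j => HasMean.sum fun k => hasMean_integral (hint j k)).const_mul _).2]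
  have hsum := Finset.sum_le_sum fun j (_ : j ∈ Finset.univ) =>
    Finset.sum_le_sum fun k (_ : k ∈ Finset.univ) => hjk j k
  simp only [Finset.sum_ite_eq, Finset.mem_univ, if_true, Finset.sum_const, Finset.card_univ,
    Fintype.card_fin, nsmul_eq_mul] at hsum
  refine (mul_le_mul_of_nonneg_left hsum (by positivity)).trans (le_of_eq ?_)
  field_simp

end Noise

/-! ### The stochastic iteration: measurability, noise, and regret. -/

section Stochastic

variable {E : Type*} [NormedAddCommGroup E] [NormedSpace ℝ E]
variable {Ω : Type*} {mΩ : MeasurableSpace Ω} {μ : Measure Ω}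
variable {ℱ : Filtration ℕ mΩ} {n : ℕ} {P : Matrix (Fin n) (Fin n) ℝ} {X : Set E} {ψ : E → ℝ}
variable {L : ℝ≥0} {f : Fin n → E → ℝ} {α : ℕ → ℝ}
variable {g z : Fin n → ℕ → Ω → StrongDual ℝ E} {x : Fin n → ℕ → Ω → E} {xs : E}

/-- The projection of the averaged dual variable in round `m + 1`. -/
def center (X : Set E) (ψ : E → ℝ) (α : ℕ → ℝ) (z : Fin n → ℕ → Ω → StrongDual ℝ E)
    (m : ℕ) (ω : Ω) : E :=
  proxPoint X ψ (α m) (mean fun j => z j (m + 1) ω)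

/-- The contribution to the regret of round `m + 1` that comes from the deviation of the received
vectors from their conditional means. -/
def noise (μ : Measure Ω) (ℱ : Filtration ℕ mΩ) (X : Set E) (ψ : E → ℝ) (α : ℕ → ℝ)
    (g z : Fin n → ℕ → Ω → StrongDual ℝ E) (xs : E) (m : ℕ) (ω : Ω) : ℝ :=
  (mean fun j => g j (m + 1) ω - (μ[g j (m + 1) | ℱ m]) ω) (xs - center X ψ α z m ω)

lemma stronglyMeasurable_sum_smul {F : Type*} [NormedAddCommGroup F] [NormedSpace ℝ F]
    {m : MeasurableSpace Ω} (a : Fin n → ℝ) {v : Fin n → Ω → F}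
    (hv : ∀ j, StronglyMeasurable[m] (v j)) :
    StronglyMeasurable[m] fun ω => ∑ j, a j • v j ω :=
  Finset.stronglyMeasurable_fun_sum _ fun j _ =>
    (continuous_const_smul (a j)).comp_stronglyMeasurable (hv j)

lemma stronglyMeasurable_mean {F : Type*} [NormedAddCommGroup F] [NormedSpace ℝ F]
    {m : MeasurableSpace Ω} {v : Fin n → Ω → F} (hv : ∀ j, StronglyMeasurable[m] (v j)) :
    StronglyMeasurable[m] fun ω => mean fun j => v j ω := by
  simpa only [mean, Finset.smul_sum] using stronglyMeasurable_sum_smul (fun _ => 1 / (n : ℝ)) hv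

lemma memLp_sum_smul {F : Type*} [NormedAddCommGroup F] [NormedSpace ℝ F]
    (a : Fin n → ℝ) {v : Fin n → Ω → F} (hv : ∀ j, MemLp (v j) 2 μ) :
    MemLp (fun ω => ∑ j, a j • v j ω) 2 μ :=
  memLp_finsetSum (f := fun j ω => a j • v j ω) _ fun j _ => (hv j).const_smul (a j)

lemma memLp_mean {F : Type*} [NormedAddCommGroup F] [NormedSpace ℝ F]
    {v : Fin n → Ω → F} (hv : ∀ j, MemLp (v j) 2 μ) :
    MemLp (fun ω => mean fun j => v j ω) 2 μ := by
  simpa only [mean, Finset.smul_sum] using memLp_sum_smul (fun _ => 1 / (n : ℝ)) hv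

/-- The shift matters: `z j (m + 1)` involves received vectors only up to time `m`, so it is known
before those of round `m + 1`. -/
lemma stronglyMeasurable_dual
    (hiter : ∀ ω, IsDualAveraging X ψ P α (fun i t => g i t ω) (fun i t => z i t ω)
      (fun i t => x i t ω))
    (horacle : IsStochasticOracle μ ℱ f L x g) (m : ℕ) (j : Fin n) :
    StronglyMeasurable[ℱ m] (fun ω => z j (m + 1) ω) := by
  induction m generalizing j with
  | zero =>
    simp only [fun ω => (hiter ω).init j]
    exact stronglyMeasurable_const
  | succ m ih =>
    simp only [fun ω => (hiter ω).dual_update j (m + 1) (Nat.le_add_left 1 m)]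
    exact (stronglyMeasurable_sum_smul (P j) fun k => (ih k).mono (ℱ.mono m.le_succ)).add
      (horacle.adapted j m)

lemma memLp_dual
    (hiter : ∀ ω, IsDualAveraging X ψ P α (fun i t => g i t ω) (fun i t => z i t ω)
      (fun i t => x i t ω))
    (horacle : IsStochasticOracle μ ℱ f L x g) (m : ℕ) (j : Fin n) :
    MemLp (fun ω => z j (m + 1) ω) 2 μ := by
  induction m generalizing j with
  | zero =>
    simp only [fun ω => (hiter ω).init j]
    exact MemLp.zero' (ε := StrongDual ℝ E)
  | succ m ih =>
    simp only [fun ω => (hiter ω).dual_update j (m + 1) (Nat.le_add_left 1 m)]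
    exact (memLp_sum_smul (P j) ih).add (horacle.memLp j m)

lemma eq_proxPoint [FiniteDimensional ℝ E] (hX : IsClosed X) (hX0 : (0 : E) ∈ X)
    (hψ : IsProximal X ψ) (hα : ∀ t, 0 < α t)
    (hiter : ∀ ω, IsDualAveraging X ψ P α (fun i t => g i t ω) (fun i t => z i t ω)
      (fun i t => x i t ω)) (j : Fin n) (m : ℕ) (ω : Ω) :
    x j (m + 1) ω = proxPoint X ψ (α m) (z j (m + 1) ω) :=
  ((hiter ω).primal_update j m).eq_of_isProjection hψ.strongConvexOn (hα m)
    (isProjection_proxPoint hX hX0 hψ (hα m) _)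

/-- The noise is centered, also when it is weighted with a function of the past. -/
lemma hasMean_smul_noise [IsProbabilityMeasure μ] (horacle : IsStochasticOracle μ ℱ f L x g)
    {xs : E} {m : ℕ}
    {V : Ω → ℝ} (hV : StronglyMeasurable[ℱ m] fun ω => V ω • (xs - center X ψ α z m ω))
    (hV2 : MemLp (fun ω => V ω • (xs - center X ψ α z m ω)) 2 μ) :
    HasMean μ (fun ω => V ω * noise μ ℱ X ψ α g z xs m ω) 0 := by
  have h : ∀ j, HasMean μ (fun ω => (g j (m + 1) ω - (μ[g j (m + 1) | ℱ m]) ω)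
      (V ω • (xs - center X ψ α z m ω))) 0 := fun j =>
    ⟨integrable_apply (memLp_sub_condExp (horacle.memLp j m)) hV2,
      integral_sub_condExp_apply (ℱ.le m) (horacle.memLp j m) hV hV2⟩
  have hsum := (HasMean.sum (s := Finset.univ) h).const_mul (1 / (n : ℝ))
  have heq : (fun ω => V ω * noise μ ℱ X ψ α g z xs m ω)
      = fun ω => 1 / (n : ℝ) * ∑ j, (g j (m + 1) ω - (μ[g j (m + 1) | ℱ m]) ω)
        (V ω • (xs - center X ψ α z m ω)) := by
    funext ω
    simp only [noise, mean, smul_apply, sum_apply, smul_eq_mul, map_smul]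
    rw [← Finset.mul_sum]
    ring
  rw [heq]
  simpa using hsum

lemma norm_condExp_oracle_le [IsProbabilityMeasure μ]
    (horacle : IsStochasticOracle μ ℱ f L x g) (j : Fin n) (m : ℕ) :
    ∀ᵐ ω ∂μ, ‖(μ[g j (m + 1) | ℱ m]) ω‖ ≤ L :=
  norm_condExp_le_of_condExp_sq_le (horacle.memLp j m) L.coe_nonneg (horacle.second_moment j m)

/-- The root mean square inherits the second moment bound of the nodes, and so has mean at most `L`;
a maximum over the nodes need not. -/
lemma hasMean_rms [IsProbabilityMeasure μ] (horacle : IsStochasticOracle μ ℱ f L x g)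
    (m : ℕ) :
    (∃ c ≤ (L : ℝ) ^ 2, HasMean μ (fun ω => (rms fun j => ‖g j (m + 1) ω‖) ^ 2) c) ∧
      ∃ c ≤ (L : ℝ), HasMean μ (fun ω => rms fun j => ‖g j (m + 1) ω‖) c := by
  have hsq : ∀ j, ∫ ω, ‖g j (m + 1) ω‖ ^ 2 ∂μ ≤ (L : ℝ) ^ 2 := by
    intro j
    rw [← integral_condExp (ℱ.le m)]
    refine (integral_mono_ae integrable_condExp (integrable_const _)
      (horacle.second_moment j m)).trans ?_
    simp
  have h2 : HasMean μ (fun ω => (rms fun j => ‖g j (m + 1) ω‖) ^ 2)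
      ((1 / (n : ℝ)) * ∑ j, ∫ ω, ‖g j (m + 1) ω‖ ^ 2 ∂μ) := by
    simp only [sq_rms]
    exact (HasMean.sum fun j => hasMean_integral
      ((horacle.memLp j m).integrable_norm_pow two_ne_zero)).const_mul _
  have hle : (1 / (n : ℝ)) * ∑ j, ∫ ω, ‖g j (m + 1) ω‖ ^ 2 ∂μ ≤ (L : ℝ) ^ 2 := by
    refine (mul_le_mul_of_nonneg_left (Finset.sum_le_sum fun j _ => hsq j)
      (by positivity)).trans ?_
    rw [Finset.sum_const, Finset.card_univ, Fintype.card_fin, nsmul_eq_mul, ← mul_assoc, one_div]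
    exact mul_le_of_le_one_left (by positivity) inv_mul_le_one
  refine ⟨⟨_, hle, h2⟩, ?_⟩
  have hmeas : AEStronglyMeasurable (fun ω => rms fun j => ‖g j (m + 1) ω‖) μ := by
    refine Real.continuous_sqrt.comp_aestronglyMeasurable (AEStronglyMeasurable.const_mul ?_ _)
    exact Finset.aestronglyMeasurable_fun_sum _ fun j _ => (horacle.memLp j m).1.norm.pow 2
  have hL2 : MemLp (fun ω => rms fun j => ‖g j (m + 1) ω‖) 2 μ :=
    (memLp_two_iff_integrable_sq hmeas).2 h2.1
  exact ⟨_, integral_le_of_integral_sq_le hL2 L.coe_nonneg (h2.2.trans_le hle),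
    hasMean_integral (hL2.integrable one_le_two)⟩

lemma hasMean_norm_oracle [IsProbabilityMeasure μ] (horacle : IsStochasticOracle μ ℱ f L x g)
    (j : Fin n) (m : ℕ) :
    ∃ c ≤ (L : ℝ), HasMean μ (fun ω => ‖g j (m + 1) ω‖) c := by
  refine ⟨_, integral_le_of_integral_sq_le (horacle.memLp j m).norm L.coe_nonneg ?_,
    hasMean_integral ((horacle.memLp j m).norm.integrable one_le_two)⟩
  rw [← integral_condExp (ℱ.le m)]
  refine (integral_mono_ae integrable_condExp (integrable_const _)
    (horacle.second_moment j m)).trans ?_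
  simp

lemma norm_deviation_le [IsProbabilityMeasure μ]
    (horacle : IsStochasticOracle μ ℱ f L x g)
    (hbound : ∀ j t, 1 ≤ t → ∀ᵐ ω ∂μ, ‖g j t ω‖ ≤ L) (j : Fin n) (m : ℕ) :
    ∀ᵐ ω ∂μ, ‖g j (m + 1) ω - (μ[g j (m + 1) | ℱ m]) ω‖ ≤ 2 * L := by
  filter_upwards [hbound j (m + 1) (Nat.le_add_left 1 m), norm_condExp_oracle_le horacle j m]
    with ω h1 h2
  exact (norm_sub_le _ _).trans (by linarith)

lemma abs_noise_le [IsProbabilityMeasure μ] (hn : 0 < n)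
    (horacle : IsStochasticOracle μ ℱ f L x g)
    (hbound : ∀ j t, 1 ≤ t → ∀ᵐ ω ∂μ, ‖g j t ω‖ ≤ L) {R : ℝ}
    (hR : ∀ m ω, ‖xs - center X ψ α z m ω‖ ≤ R) (m : ℕ) :
    ∀ᵐ ω ∂μ, |noise μ ℱ X ψ α g z xs m ω| ≤ 2 * L * R := by
  have hn' : (0 : ℝ) < n := Nat.cast_pos.2 hn
  filter_upwards [ae_all_iff.2 fun j => norm_deviation_le horacle hbound j m] with ω hω
  refine ((mean fun j => g j (m + 1) ω - (μ[g j (m + 1) | ℱ m]) ω).le_opNorm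
    (xs - center X ψ α z m ω)).trans
    (mul_le_mul ?_ (hR m ω) (norm_nonneg _) (by positivity))
  rw [mean, norm_smul, Real.norm_of_nonneg (by positivity), one_div_mul_eq_div, div_le_iff₀ hn']
  refine (norm_sum_le _ _).trans ((Finset.sum_le_sum fun j _ => hω j).trans (le_of_eq ?_))
  rw [Finset.sum_const, Finset.card_univ, Fintype.card_fin, nsmul_eq_mul, mul_comm]

variable [FiniteDimensional ℝ E]

lemma memLp_proxPoint [IsProbabilityMeasure μ] (hX : IsClosed X) (hX0 : (0 : E) ∈ X)
    (hψ : IsProximal X ψ)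
    {a : ℝ} (ha : 0 < a) {v : Ω → StrongDual ℝ E} (hv : MemLp v 2 μ) :
    MemLp (fun ω => proxPoint X ψ a (v ω)) 2 μ :=
  hv.of_le_mul ((continuous_proxPoint hX hX0 hψ ha).comp_aestronglyMeasurable hv.1)
    (ae_of_all _ fun ω => norm_proxPoint_le hX hX0 hψ ha (v ω))

lemma stronglyMeasurable_center (hX : IsClosed X) (hX0 : (0 : E) ∈ X) (hψ : IsProximal X ψ)
    (hα : ∀ t, 0 < α t)
    (hiter : ∀ ω, IsDualAveraging X ψ P α (fun i t => g i t ω) (fun i t => z i t ω)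
      (fun i t => x i t ω))
    (horacle : IsStochasticOracle μ ℱ f L x g) (m : ℕ) :
    StronglyMeasurable[ℱ m] (center X ψ α z m) := by
  exact (continuous_proxPoint hX hX0 hψ (hα m)).comp_stronglyMeasurable
    (stronglyMeasurable_mean (stronglyMeasurable_dual hiter horacle m))

lemma memLp_center [IsProbabilityMeasure μ] (hX : IsClosed X) (hX0 : (0 : E) ∈ X)
    (hψ : IsProximal X ψ) (hα : ∀ t, 0 < α t)
    (hiter : ∀ ω, IsDualAveraging X ψ P α (fun i t => g i t ω) (fun i t => z i t ω)
      (fun i t => x i t ω))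
    (horacle : IsStochasticOracle μ ℱ f L x g) (m : ℕ) :
    MemLp (center X ψ α z m) 2 μ := by
  exact memLp_proxPoint hX hX0 hψ (hα m) (memLp_mean (memLp_dual hiter horacle m))

lemma stronglyMeasurable_noise (hX : IsClosed X) (hX0 : (0 : E) ∈ X) (hψ : IsProximal X ψ)
    (hα : ∀ t, 0 < α t)
    (hiter : ∀ ω, IsDualAveraging X ψ P α (fun i t => g i t ω) (fun i t => z i t ω)
      (fun i t => x i t ω))
    (horacle : IsStochasticOracle μ ℱ f L x g) (xs : E) (m : ℕ) :
    StronglyMeasurable[ℱ (m + 1)] (noise μ ℱ X ψ α g z xs m) := by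
  refine isBoundedBilinearMap_apply.continuous.comp_stronglyMeasurable
    (StronglyMeasurable.prodMk ?_ ?_)
  · exact stronglyMeasurable_mean fun j =>
      (horacle.adapted j m).sub (stronglyMeasurable_condExp.mono (ℱ.mono m.le_succ))
  · exact stronglyMeasurable_const.sub
      ((stronglyMeasurable_center hX hX0 hψ hα hiter horacle m).mono (ℱ.mono m.le_succ))

/-- The regret of the running average of node `i`. -/
lemma ae_objective_sub_le [IsProbabilityMeasure μ] (hX : IsClosed X) (hX0 : (0 : E) ∈ X)
    (hψ : IsProximal X ψ) (hP : P ∈ doublyStochastic ℝ (Fin n)) (hgap : sigma2 P < 1)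
    {K T : ℕ} (hK : √n * sigma2 P ^ K ≤ 1 / T)
    (hfconvex : ∀ i, ConvexOn ℝ univ (f i)) (hfLip : ∀ i, LipschitzOnWith L (f i) X)
    (hα : ∀ t, 0 < α t) (hanti : Antitone α)
    (hiter : ∀ ω, IsDualAveraging X ψ P α (fun i t => g i t ω) (fun i t => z i t ω)
      (fun i t => x i t ω))
    (horacle : IsStochasticOracle μ ℱ f L x g) (hxs : xs ∈ X) (hT : 1 ≤ T) (i : Fin n) :
    ∀ᵐ ω ∂μ, T * (objective f (runningAverage (fun t => x i t ω) T) - objective f xs)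
      ≤ 1 / α T * ψ xs
        + ∑ m ∈ Finset.range T, α m / 2 * (rms fun j => ‖g j (m + 1) ω‖) ^ 2
        + L * ∑ m ∈ Finset.range T, α m *
          networkError P K T (fun q l => ‖g l (q + 1) ω‖)
            (fun q => rms fun l => ‖g l (q + 1) ω‖) i m
        + ∑ m ∈ Finset.range T, noise μ ℱ X ψ α g z xs m ω := by
  have h1 : ∀ᵐ ω ∂μ, ∀ m j, (μ[g j (m + 1) | ℱ m]) ω
      ∈ subdifferential (f j) (x j (m + 1) ω) :=
    ae_all_iff.2 fun m => ae_all_iff.2 fun j => horacle.unbiased j m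
  have h2 : ∀ᵐ ω ∂μ, ∀ m j, ‖(μ[g j (m + 1) | ℱ m]) ω‖ ≤ L :=
    ae_all_iff.2 fun m => ae_all_iff.2 fun j => norm_condExp_oracle_le horacle j m
  filter_upwards [h1, h2] with ω hs hsL
  have hx := fun j m => eq_proxPoint hX hX0 hψ hα hiter j m ω
  refine (objective_runningAverage_sub_le hfconvex hT (fun t => x i t ω) xs).trans ?_
  have h := sum_objective_sub_le hX hX0 hψ i.pos hP hgap hK hα hanti hfLip
    (Z := fun m j => z j (m + 1) ω) (g := fun m j => g j (m + 1) ω)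
    (s := fun m j => (μ[g j (m + 1) | ℱ m]) ω) (funext fun j => (hiter ω).init j)
    (fun m => funext fun j => (hiter ω).dual_update j (m + 1) (Nat.le_add_left 1 m))
    (fun m j => by simpa only [hx] using hs m j) hsL hxs i
  simp only [← hx] at h
  refine h.trans (le_of_eq ?_)
  rw [sub_eq_add_neg, ← Finset.sum_neg_distrib]
  congr 1
  refine Finset.sum_congr rfl fun m _ => ?_
  rw [noise, ← map_neg, neg_sub, center]
  congr 1
  simp [mean, smul_sub]

/-- Projections grow at most linearly in the dual variables, so the iterates are square integrable.
Convexity makes each `f j` continuous, and the Lipschitz bound against the origin dominates it. -/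
lemma integrable_objective_runningAverage [IsProbabilityMeasure μ] (hX : IsClosed X)
    (hX0 : (0 : E) ∈ X) (hXconvex : Convex ℝ X) (hψ : IsProximal X ψ)
    (hfconvex : ∀ i, ConvexOn ℝ univ (f i)) (hfLip : ∀ i, LipschitzOnWith L (f i) X)
    (hα : ∀ t, 0 < α t)
    (hiter : ∀ ω, IsDualAveraging X ψ P α (fun i t => g i t ω) (fun i t => z i t ω)
      (fun i t => x i t ω))
    (horacle : IsStochasticOracle μ ℱ f L x g) {T : ℕ} (hT : 1 ≤ T) (i : Fin n) :
    Integrable (fun ω => objective f (runningAverage (fun t => x i t ω) T)) μ := by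
  have hT' : (0 : ℝ) < T := Nat.cast_pos.2 hT
  have hx : ∀ t ∈ Finset.Icc 1 T, MemLp (fun ω => x i t ω) 2 μ := by
    intro t ht
    obtain ⟨m, rfl⟩ := Nat.exists_eq_add_of_le' (Finset.mem_Icc.1 ht).1
    simp only [eq_proxPoint hX hX0 hψ hα hiter i m]
    exact memLp_proxPoint hX hX0 hψ (hα m) (memLp_dual hiter horacle m i)
  have havg : MemLp (fun ω => runningAverage (fun t => x i t ω) T) 2 μ :=
    (memLp_finsetSum _ hx).const_smul (1 / (T : ℝ))
  have hmem : ∀ ω, runningAverage (fun t => x i t ω) T ∈ X := by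
    intro ω
    rw [runningAverage, Finset.smul_sum]
    refine hXconvex.sum_mem (fun _ _ => by positivity) (by simp [hT'.ne']) fun t ht => ?_
    obtain ⟨m, rfl⟩ := Nat.exists_eq_add_of_le' (Finset.mem_Icc.1 ht).1
    exact ((hiter ω).primal_update i m).1
  have hfint : ∀ j, Integrable (fun ω => f j (runningAverage (fun t => x i t ω) T)) μ := by
    intro j
    have hcont : Continuous (f j) := (hfconvex j).locallyLipschitz.continuous
    refine (((havg.norm.integrable one_le_two).const_mul (L : ℝ)).add
      (integrable_const |f j 0|)).mono' (hcont.comp_aestronglyMeasurable havg.1)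
      (ae_of_all _ fun ω => ?_)
    have h := (hfLip j).dist_le_mul _ (hmem ω) _ hX0
    rw [Real.dist_eq, dist_zero_right] at h
    have h2 := abs_sub_abs_le_abs_sub (f j (runningAverage (fun t => x i t ω) T)) (f j 0)
    simp only [Pi.add_apply, Real.norm_eq_abs]
    linarith
  exact (integrable_finsetSum _ fun j _ => hfint j).const_mul _

lemma integral_objective_sub_le [IsProbabilityMeasure μ] (hX : IsClosed X) (hX0 : (0 : E) ∈ X)
    (hXconvex : Convex ℝ X)
    (hψ : IsProximal X ψ) (hP : P ∈ doublyStochastic ℝ (Fin n)) (hgap : sigma2 P < 1)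
    {K T : ℕ} (hK : √n * sigma2 P ^ K ≤ 1 / T)
    (hfconvex : ∀ i, ConvexOn ℝ univ (f i)) (hfLip : ∀ i, LipschitzOnWith L (f i) X)
    (hα : ∀ t, 0 < α t) (hanti : Antitone α)
    (hiter : ∀ ω, IsDualAveraging X ψ P α (fun i t => g i t ω) (fun i t => z i t ω)
      (fun i t => x i t ω))
    (horacle : IsStochasticOracle μ ℱ f L x g) (hxs : xs ∈ X) (hT : 1 ≤ T) (i : Fin n) :
    T * ((∫ ω, objective f (runningAverage (fun t => x i t ω) T) ∂μ) - objective f xs)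
      ≤ 1 / α T * ψ xs + ∑ m ∈ Finset.range T, α m / 2 * (L : ℝ) ^ 2
        + L * ∑ m ∈ Finset.range T, α m * (3 * L * if m = 0 then 0 else (K + 1 : ℝ)) := by
  -- The network error is linear in the norms, so its mean is the same expression in their means, to
  -- which the deterministic estimate applies.
  choose c2 hc2 hm2 using fun m => (hasMean_rms (μ := μ) horacle m).1
  choose cρ hcρ hmρ using fun m => (hasMean_rms (μ := μ) horacle m).2
  choose ce hce hme using fun (m : ℕ) (j : Fin n) => hasMean_norm_oracle (μ := μ) horacle j m
  have hnoise : ∀ m, HasMean μ (noise μ ℱ X ψ α g z xs m) 0 := by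
    intro m
    have h := hasMean_smul_noise (X := X) (ψ := ψ) (α := α) (z := z) horacle (xs := xs) (m := m)
      (V := fun _ => 1)
    simp only [one_smul, one_mul] at h
    exact h (stronglyMeasurable_const.sub
        (stronglyMeasurable_center hX hX0 hψ hα hiter horacle m))
      ((memLp_const xs).sub (memLp_center hX hX0 hψ hα hiter horacle m))
  have hint := integrable_objective_runningAverage hX hX0 hXconvex hψ hfconvex hfLip hα hiter
    horacle hT i
  have hleft := ((hasMean_integral hint).add (hasMean_const (-objective f xs))).const_mul (T : ℝ)
  have hright := (((hasMean_const (μ := μ) (1 / α T * ψ xs)).add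
    (HasMean.sum (s := Finset.range T) fun m => (hm2 m).const_mul (α m / 2))).add
    ((HasMean.sum (s := Finset.range T) fun m =>
      (hasMean_networkError (K := K) (T := T) (P := P) hme hmρ i m).const_mul
        (α m)).const_mul (L : ℝ))).add (HasMean.sum (s := Finset.range T) hnoise)
  have hmono := integral_mono_ae hleft.1 hright.1 (by
    filter_upwards [ae_objective_sub_le hX hX0 hψ hP hgap hK hfconvex hfLip hα hanti hiter horacle
      hxs hT i] with ω hω
    simpa only [← sub_eq_add_neg] using hω)
  rw [hleft.2, hright.2, ← sub_eq_add_neg] at hmono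
  refine hmono.trans ?_
  rw [Finset.sum_const_zero, add_zero]
  refine add_le_add (add_le_add_right (Finset.sum_le_sum fun m _ => ?_) _)
    (mul_le_mul_of_nonneg_left (Finset.sum_le_sum fun m hm => ?_) L.coe_nonneg)
  · exact mul_le_mul_of_nonneg_left (hc2 m) (div_nonneg (hα m).le zero_le_two)
  · exact mul_le_mul_of_nonneg_left
      (networkError_le hP L.coe_nonneg hce hcρ i (Finset.mem_range.1 hm)) (hα m).le

/-- Bounded received vectors: the regret is bounded up to the noise. -/
lemma ae_objective_sub_le_of_bounded [IsProbabilityMeasure μ] (hX : IsClosed X)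
    (hX0 : (0 : E) ∈ X)
    (hψ : IsProximal X ψ) (hP : P ∈ doublyStochastic ℝ (Fin n)) (hgap : sigma2 P < 1)
    {K T : ℕ} (hK : √n * sigma2 P ^ K ≤ 1 / T)
    (hfconvex : ∀ i, ConvexOn ℝ univ (f i)) (hfLip : ∀ i, LipschitzOnWith L (f i) X)
    (hα : ∀ t, 0 < α t) (hanti : Antitone α)
    (hiter : ∀ ω, IsDualAveraging X ψ P α (fun i t => g i t ω) (fun i t => z i t ω)
      (fun i t => x i t ω))
    (horacle : IsStochasticOracle μ ℱ f L x g) (hxs : xs ∈ X) (hT : 1 ≤ T) (i : Fin n)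
    (hbound : ∀ j t, 1 ≤ t → ∀ᵐ ω ∂μ, ‖g j t ω‖ ≤ L) :
    ∀ᵐ ω ∂μ, T * (objective f (runningAverage (fun t => x i t ω) T) - objective f xs)
      ≤ (1 / α T * ψ xs + ∑ m ∈ Finset.range T, α m / 2 * (L : ℝ) ^ 2
        + L * ∑ m ∈ Finset.range T, α m * (3 * L * if m = 0 then 0 else (K + 1 : ℝ)))
        + ∑ m ∈ Finset.range T, noise μ ℱ X ψ α g z xs m ω := by
  have hall : ∀ᵐ ω ∂μ, ∀ m j, ‖g j (m + 1) ω‖ ≤ L :=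
    ae_all_iff.2 fun m => ae_all_iff.2 fun j => hbound j (m + 1) (Nat.le_add_left 1 m)
  filter_upwards [hall, ae_objective_sub_le hX hX0 hψ hP hgap hK hfconvex hfLip hα
      hanti hiter horacle hxs hT i] with ω hω h
  have hρ2 : ∀ m, (rms fun j => ‖g j (m + 1) ω‖) ^ 2 ≤ (L : ℝ) ^ 2 := by
    intro m
    rw [sq_rms]
    refine (mul_le_mul_of_nonneg_left (Finset.sum_le_sum fun j _ =>
      pow_le_pow_left₀ (norm_nonneg _) (hω m j) 2) (by positivity)).trans ?_
    rw [Finset.sum_const, Finset.card_univ, Fintype.card_fin, nsmul_eq_mul, ← mul_assoc, one_div]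
    exact mul_le_of_le_one_left (by positivity) inv_mul_le_one
  refine h.trans (add_le_add_left (add_le_add (add_le_add_right
    (Finset.sum_le_sum fun m _ => ?_) _)
    (mul_le_mul_of_nonneg_left (Finset.sum_le_sum fun m hm => ?_) L.coe_nonneg)) _)
  · exact mul_le_mul_of_nonneg_left (hρ2 m) (div_nonneg (hα m).le zero_le_two)
  · exact mul_le_mul_of_nonneg_left (networkError_le hP L.coe_nonneg hω
      (fun q => le_of_sq_le_sq (hρ2 q) L.coe_nonneg) i (Finset.mem_range.1 hm)) (hα m).le

lemma integral_mul_noise_eq_zero [IsProbabilityMeasure μ] (hX : IsClosed X) (hX0 : (0 : E) ∈ X)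
    (hψ : IsProximal X ψ) (hα : ∀ t, 0 < α t)
    (hiter : ∀ ω, IsDualAveraging X ψ P α (fun i t => g i t ω) (fun i t => z i t ω)
      (fun i t => x i t ω))
    (horacle : IsStochasticOracle μ ℱ f L x g) {R : ℝ}
    (hR : ∀ m ω, ‖xs - center X ψ α z m ω‖ ≤ R) (m : ℕ) {V : Ω → ℝ}
    (hV : StronglyMeasurable[ℱ m] V) (hC : ∃ C, ∀ᵐ ω ∂μ, |V ω| ≤ C) :
    ∫ ω, V ω * noise μ ℱ X ψ α g z xs m ω ∂μ = 0 := by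
  obtain ⟨C, hC⟩ := hC
  have hmeas : StronglyMeasurable[ℱ m] fun ω => V ω • (xs - center X ψ α z m ω) :=
    hV.smul (stronglyMeasurable_const.sub
      (stronglyMeasurable_center hX hX0 hψ hα hiter horacle m))
  refine (hasMean_smul_noise horacle hmeas
    (MemLp.of_bound (hmeas.mono (ℱ.le m)).aestronglyMeasurable (C * R) ?_)).2
  filter_upwards [hC] with ω hω
  rw [norm_smul]
  exact mul_le_mul hω (hR m ω) (norm_nonneg _) ((abs_nonneg _).trans hω)

end Stochastic

end DistributedDualAveraging
end

/-! ### The theorem. -/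

open DistributedDualAveraging in
theorem theorem4
    {E : Type*} [NormedAddCommGroup E] [NormedSpace ℝ E] [FiniteDimensional ℝ E]
    {Ω : Type*} {mΩ : MeasurableSpace Ω} (μ : Measure Ω) [IsProbabilityMeasure μ]
    (ℱ : Filtration ℕ mΩ)
    {n : ℕ} (P : Matrix (Fin n) (Fin n) ℝ) (hP : P ∈ doublyStochastic ℝ (Fin n))
    (hgap : sigma2 P < 1)
    (X : Set E) (hXclosed : IsClosed X) (hXconvex : Convex ℝ X) (hX0 : (0 : E) ∈ X)
    (ψ : E → ℝ) (hψ : IsProximal X ψ)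
    (L : ℝ≥0) (f : Fin n → E → ℝ) (hfconvex : ∀ i, ConvexOn ℝ Set.univ (f i))
    (hfLip : ∀ i, LipschitzOnWith L (f i) X)
    (α : ℕ → ℝ) (hαpos : ∀ t, 0 < α t) (hαanti : Antitone α)
    (g z : Fin n → ℕ → Ω → StrongDual ℝ E) (x : Fin n → ℕ → Ω → E)
    (hiter : ∀ ω, IsDualAveraging X ψ P α (fun i t => g i t ω) (fun i t => z i t ω)
      (fun i t => x i t ω))
    (horacle : IsStochasticOracle μ ℱ f L x g)
    (xstar : E) (hxstar : xstar ∈ X) (T : ℕ) (hT : 1 ≤ T) (i : Fin n) :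
    -- bound in expectation
    (Integrable (fun ω => objective f (runningAverage (fun t => x i t ω) T)) μ ∧
      (∫ ω, objective f (runningAverage (fun t => x i t ω) T) ∂μ) - objective f xstar
        ≤ errorBound n T L α (ψ xstar) (sigma2 P)) ∧
    -- bounds with high probability, for a set of finite radius and bounded gradient estimates
    (∀ R : ℝ, IsLUB ((fun y => ‖y - xstar‖) '' X) R →
      (∀ j t, 1 ≤ t → ∀ᵐ ω ∂μ, ‖g j t ω‖ ≤ L) →
      (∀ δ : ℝ, 0 < δ → δ < 1 →
        1 - δ ≤ μ.real {ω |
          objective f (runningAverage (fun t => x i t ω) T) - objective f xstar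
            ≤ errorBound n T L α (ψ xstar) (sigma2 P)
              + 8 * L * R * √(Real.log (1 / δ) / T)}) ∧
      ((∀ t j k, j ≠ k → CondUncorrelated μ (ℱ t) (g j (t + 1)) (g k (t + 1))) →
        ∀ δ : ℝ, 0 < δ → δ < 1 →
          1 - δ ≤ μ.real {ω |
            objective f (runningAverage (fun t => x i t ω) T) - objective f xstar
              ≤ errorBound n T L α (ψ xstar) (sigma2 P)
                + 3 * L * R * Real.log (1 / δ) / T
                + 4 * L * R * √(Real.log (1 / δ) / (n * T))})) := by
  have hn : 0 < n := i.pos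
  have hT' : (0 : ℝ) < T := Nat.cast_pos.2 hT
  set K := ⌈Real.log (T * √n) / (1 - sigma2 P)⌉₊ with hKdef
  have hK := sqrt_mul_sigma2_pow_le hgap hn hT (Nat.le_ceil _)
  have hlog : 0 ≤ Real.log (T * √n) / (1 - sigma2 P) := by
    refine div_nonneg (Real.log_nonneg ?_) (by linarith)
    exact one_le_mul_of_one_le_of_one_le (Nat.one_le_cast.2 hT)
      (Real.one_le_sqrt.2 (Nat.one_le_cast.2 hn))
  have hB := le_mul_errorBound hn hT hgap (Nat.ceil_lt_add_one hlog).le hαpos L (ψ xstar)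
  refine ⟨⟨integrable_objective_runningAverage hXclosed hX0 hXconvex hψ hfconvex hfLip hαpos hiter
    horacle hT i, ?_⟩, fun R hR hbound => ?_⟩
  · exact le_of_mul_le_mul_left ((integral_objective_sub_le hXclosed hX0 hXconvex hψ hP hgap hK
      hfconvex hfLip hαpos hαanti hiter horacle hxstar hT i).trans hB) hT'
  have hcenter : ∀ m ω, ‖xstar - center X ψ α z m ω‖ ≤ R := fun m ω => by
    rw [norm_sub_rev]
    exact hR.1 (mem_image_of_mem _ (isProjection_proxPoint hXclosed hX0 hψ (hαpos m) _).1)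
  have hR0 : 0 ≤ R := by simpa using hR.1 (mem_image_of_mem _ hxstar)
  have hb0 : (0 : ℝ) ≤ 2 * L * R := by positivity
  have hmeas := stronglyMeasurable_noise hXclosed hX0 hψ hαpos hiter horacle xstar
  have hb := abs_noise_le hn horacle hbound hcenter
  have hmean : ∀ k (V : Ω → ℝ), StronglyMeasurable[ℱ k] V → (∃ C, ∀ᵐ ω ∂μ, |V ω| ≤ C) →
      ∫ ω, V ω * noise μ ℱ X ψ α g z xstar k ω ∂μ = 0 := fun k V hV hC =>
    integral_mul_noise_eq_zero hXclosed hX0 hψ hαpos hiter horacle hcenter k hV hC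
  have hregret := ae_objective_sub_le_of_bounded hXclosed hX0 hψ hP hgap hK hfconvex hfLip hαpos
    hαanti hiter horacle hxstar hT i hbound
  -- Up to a null set, a bound on the total noise implies the regret bound, so only the noise needs
  -- a tail estimate.
  have htransfer : ∀ s d δ : ℝ, s ≤ T * d →
      1 - δ ≤ μ.real {ω | ∑ m ∈ Finset.range T, noise μ ℱ X ψ α g z xstar m ω ≤ s} →
      1 - δ ≤ μ.real {ω | objective f (runningAverage (fun t => x i t ω) T) - objective f xstar
        ≤ errorBound n T L α (ψ xstar) (sigma2 P) + d} := by
    intro s d δ hs h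
    refine h.trans (ENNReal.toReal_mono (measure_ne_top _ _) (measure_mono_ae ?_))
    filter_upwards [hregret] with ω hω
    intro (h1 : ∑ m ∈ Finset.range T, noise μ ℱ X ψ α g z xstar m ω ≤ s)
    change objective f (runningAverage (fun t => x i t ω) T) - objective f xstar
      ≤ errorBound n T L α (ψ xstar) (sigma2 P) + d
    refine le_of_mul_le_mul_left ?_ hT'
    rw [mul_add]
    linarith
  refine ⟨fun δ hδ hδ1 => ?_, fun hunc δ hδ hδ1 => ?_⟩
  · refine htransfer _ _ δ (le_of_eq ?_)
      (one_sub_le_real_azuma hmeas hb hb0 hmean hT hδ hδ1)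
    have : √(Real.log (1 / δ) * T) = T * √(Real.log (1 / δ) / T) := by
      rw [show Real.log (1 / δ) * T = (T : ℝ) ^ 2 * (Real.log (1 / δ) / T) by field_simp,
        Real.sqrt_mul (by positivity), Real.sqrt_sq hT'.le]
    rw [this]
    ring
  · have hvar : ∀ k (V : Ω → ℝ), StronglyMeasurable[ℱ k] V → (∃ C, ∀ᵐ ω ∂μ, |V ω| ≤ C) →
        (∀ ω, 0 ≤ V ω) → ∫ ω, V ω * noise μ ℱ X ψ α g z xstar k ω ^ 2 ∂μ
          ≤ (2 * L * R) ^ 2 / n * ∫ ω, V ω ∂μ := by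
      intro k V hV ⟨C, hC⟩ hV0
      exact integral_mul_sq_mean_apply_le (ℱ.le k) hn
        (fun j => memLp_sub_condExp (horacle.memLp j k))
        (fun j => norm_deviation_le horacle hbound j k) (by positivity)
        (fun j l hjl u v => hunc k j l hjl u v)
        (stronglyMeasurable_const.sub
          (stronglyMeasurable_center hXclosed hX0 hψ hαpos hiter horacle k))
        (hcenter k) hV hC hV0
    have h := htransfer _ (3 * L * R * Real.log (1 / δ) / T
        + 4 * L * R * √(Real.log (1 / δ) / (n * T))) δ (le_of_eq ?_)
      (one_sub_le_real_bernstein hn hmeas hb hb0 hmean hvar hT hδ hδ1)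
    · simpa only [add_assoc] using h
    · have hn' : (0 : ℝ) < n := Nat.cast_pos.2 hn
      have : √(Real.log (1 / δ) * (T / n)) = T * √(Real.log (1 / δ) / (n * T)) := by
        rw [show Real.log (1 / δ) * (T / n) = (T : ℝ) ^ 2 * (Real.log (1 / δ) / (n * T)) by
          field_simp, Real.sqrt_mul (by positivity), Real.sqrt_sq hT'.le]
      rw [this]
      field_simp
      ring
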